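/- Let $N\ge 2$ be an integer, $n=N-1$, and let $\mathfrak s_\kappa$ be the solution of $f''+\kappa f=0$, $f(0)=0$, $f'(0)=1$, $T_\kappa\in(0,\infty]$ its first positive zero, and $\mathfrak D_{K,N}(t)=\mathfrak s_{K/n}(t)^{-n}\int_0^t\mathfrak s_{K/n}(s)^{n}\,ds$ for $0<t<T_{K/n}$ (so $\mathfrak D_{0,N}(t)=t/N$). Let $X$ be a region of a time-oriented Lorentzian manifold of signature $(-,+,\dots,+)$, with its volume measure $\mathfrak m$. Let $\le$ be the causal relation of $X$ ($x\le y$ if $x=y$ or some future-directed Lipschitz causal curve inside $X$ goes from $x$ to $y$), and let $\tau(x,y)$ be the supremum of the Lorentzian lengths of the future-directed Lipschitz timelike curves inside $X$ from $x$ to $y$ ($0$ if there is none); $x\ll y$ means $\tau(x,y)>0$. For an achronal set $V$ let $\tau_V(x)=\sup_{y\in V}\tau(y,x)$ on $I^+(V)$, $\tau_V(x)=-\sup_{y\in V}\tau(x,y)$ on $I^-(V)$, $\tau_V=0$ elsewhere; for $S\subset I^+(V)$ put $\mathrm{dist}(V,S)=\inf_S\tau_V$, and let $C(V,S)$ be the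 union of the geodesics (continuous $\gamma:[0,1]\to X$ with $\tau(\gamma_s,\gamma_t)=(t-s)\,\tau(\gamma_0,\gamma_1)$ for $s<t$) from $\gamma_0\in V$ to $\gamma_1\in S$ of $\tau$-length $\tau_V(\gamma_1)$. Let $$\mathfrak m^+(S)=\inf_{U\supset S\text{ open}}\ \limsup_{\varepsilon\downarrow0}\frac{\mathfrak m(\tau_S^{-1}((0,\varepsilon))\cap U)}{\varepsilon}$$ be the future Minkowski content. The isoperimetric-type inequality $$\mathfrak m^+(S)\,\mathfrak D_{K,N}(\mathrm{dist}(V,S))\le\mathfrak m(C(V,S)),\qquad\text{for }K=0:\quad \mathfrak m^+(S)\,\mathrm{dist}(V,S)\le N\,\mathfrak m(C(V,S)),$$ concerns Borel, achronal, timelike complete sets $V$ and compact acausal sets $S\subset I^+(V)$ with $S\subset I^-(B)$ for some $B\subset X$. It is sharp, in the following sense. Let $a>0$ and $H_a=\{(x,t)\in\mathbb R^{n}\times\mathbb R: t^2-\|x\|^2=1,\ t>0,\ \|x\|\le a\}$. * $K=0$. In the $N$-dimensional Minkowski space $\mathbb R^n\times\mathbb R$ with metric $dx^2-dt^2$, let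 $X$ be the cone $\{t\ge\|x\|\sqrt{1+a^2}/a\}$, $V=\{0\}$, and, for $\rho>0$, $S=\{(x,t)\in X:t^2-\|x\|^2=\rho^2\}=\rho H_a$. * $K>0$. Let $\kappa=K/(N-1)$ and let $M$ be the $N$-dimensional anti-de Sitter space $\{\|x\|^2-t^2-w^2=-1/\kappa\}\subset\mathbb R^{n}\times\mathbb R\times\mathbb R$ with the metric induced by $dx^2-dt^2-dw^2$ and the time orientation given by $w\,\partial_t-t\,\partial_w$ (constant sectional curvature $-K/(N-1)$; $\mathrm{Ric}(v,v)=K$ for unit timelike $v$). * $K<0$. Let $\kappa=K/(N-1)$ and let $M$ be the $N$-dimensional de Sitter space $\{\|x\|^2-t^2+w^2=1/|\kappa|\}$ with the metric induced by $dx^2-dt^2+dw^2$ and the time orientation in which $t$ increases (constant sectional curvature $-K/(N-1)$; $\mathrm{Ric}(v,v)=K$ for unit timelike $v$). For $K\ne0$ let $p=(0,0,|\kappa|^{-1/2})\in M$, regard $H_a$ as a set of unit timelike vectors tangent to $M$ at $p$ (with zero $w$-component), let $X=\{\exp_p(ru):0\le r<T_\kappa,\ u\in H_a\}$, $V=\{p\}$,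 and, for $0<\rho<T_\kappa$, $S=\exp_p(\rho H_a)$. On $X\setminus\{p\}$, at points $\exp_p(ru)$, the metric is $-dr^2+\mathfrak s_\kappa(r)^2 g_{\mathbb H^{n}}$. In each of the three cases, for all such $a$ and $\rho$, the sets $V$, $S$ are as required above, $\mathrm{dist}(V,S)=\rho$, $\mathfrak m^+(S)$ equals the Riemannian area $\mathrm{Area}(S)$ of $S$ for the induced metric, $0<\mathfrak m(C(V,S))<\infty$, and equality holds: $$\mathfrak m^+(S)\,\mathfrak D_{K,N}(\mathrm{dist}(V,S))=\mathfrak m(C(V,S));$$ for $K=0$ this reads $\mathrm{Area}(S)\,\mathrm{dist}(V,S)=N\,\mathfrak m(C(V,S))$. -/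

import Mathlib

open Set Filter Topology MeasureTheory

noncomputable section

namespace LorentzIsop

/-! ### Measured Lorentzian spaces: causal relation, time separation, reference measure -/

/-- The data of a measured Lorentzian space on a topological space `X`: causal relation `≤`,
time separation `τ` with values in `[0, ∞]`, and reference measure. -/
structure Space (X : Type*) [MeasurableSpace X] where
  le : X → X → Prop
  τ : X → X → ENNReal
  vol : Measure X

namespace Space

variable {X : Type*} [TopologicalSpace X] [MeasurableSpace X] (L : Space X)

/-- Chronological relation `x ≪ y`. -/
def chron (x y : X) : Prop := 0 < L.τ x y

/-- Chronological future `I⁺(A)`. -/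
def chronFuture (A : Set X) : Set X := {y | ∃ x ∈ A, L.chron x y}

/-- Chronological past `I⁻(A)`. -/
def chronPast (A : Set X) : Set X := {x | ∃ y ∈ A, L.chron x y}

def Achronal (A : Set X) : Prop := ∀ x ∈ A, ∀ y ∈ A, ¬ L.chron x y

/-- No two distinct points of `A` are causally related. -/
def Acausal (A : Set X) : Prop := ∀ x ∈ A, ∀ y ∈ A, L.le x y → x = y

/-- `V` is future and past timelike complete: `J⁻(x) ∩ V` for `x ∈ I⁺(V)` and `J⁺(x) ∩ V` for
`x ∈ I⁻(V)` have compact closure, contained in `V`. -/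
def TimelikeComplete (V : Set X) : Prop :=
  (∀ x ∈ L.chronFuture V, IsCompact (closure ({y | L.le y x} ∩ V)) ∧
    closure ({y | L.le y x} ∩ V) ⊆ V) ∧
  (∀ x ∈ L.chronPast V, IsCompact (closure ({y | L.le x y} ∩ V)) ∧
    closure ({y | L.le x y} ∩ V) ⊆ V)

open Classical in
/-- Signed time separation `τ_V` from an achronal set `V`. -/
def tauFrom (V : Set X) (x : X) : EReal :=
  if x ∈ L.chronFuture V then ((⨆ y ∈ V, L.τ y x : ENNReal) : EReal)
  else if x ∈ L.chronPast V then -((⨆ y ∈ V, L.τ x y : ENNReal) : EReal)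
  else 0

/-- `dist(V, S) = inf_S τ_V`. -/
def dist (V S : Set X) : EReal := ⨅ x ∈ S, L.tauFrom V x

/-- The `τ`-length of a curve: infimum of `∑ τ(γ(tᵢ), γ(tᵢ₊₁))` over all partitions
`0 = t₀ < t₁ < ⋯ < t_k = 1`. -/
def length (γ : C(unitInterval, X)) : ENNReal :=
  ⨅ (k : ℕ) (t : Fin (k + 1) → unitInterval)
    (_ : StrictMono t ∧ t 0 = 0 ∧ t (Fin.last k) = 1),
    ∑ i : Fin k, L.τ (γ (t i.castSucc)) (γ (t i.succ))

/-- Causal geodesics, parametrized proportionally to `τ`-arclength. -/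
def Geo : Set C(unitInterval, X) :=
  {γ | ∀ s t : unitInterval, s < t →
    L.τ (γ s) (γ t) = ENNReal.ofReal ((t : ℝ) - (s : ℝ)) * L.τ (γ 0) (γ 1)}

/-- The conical region `C(V, S)` spanned by the `τ_V`-maximizing geodesics from `V` to `S`. -/
def cone (V S : Set X) : Set X :=
  {x | ∃ γ ∈ L.Geo, ∃ t : unitInterval, γ 0 ∈ V ∧ γ 1 ∈ S ∧
    ((L.length γ : ENNReal) : EReal) = L.tauFrom V (γ 1) ∧ x = γ t}

/-- Future timelike Minkowski content `𝔪⁺(A)`. -/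
def minkowskiContent (A : Set X) : ENNReal :=
  ⨅ (U : Set X) (_ : IsOpen U ∧ A ⊆ U),
    limsup (fun ε : ℝ =>
      L.vol (L.tauFrom A ⁻¹' Ioo (0 : EReal) (ε : EReal) ∩ U) / ENNReal.ofReal ε) (𝓝[>] 0)

/-- The requirements on the pair `(V, S)` in the isoperimetric-type inequality. -/
structure Admissible (V S : Set X) : Prop where
  borel : MeasurableSet V
  achronal : L.Achronal V
  timelikeComplete : L.TimelikeComplete V
  compact : IsCompact S
  acausal : L.Acausal S
  future : S ⊆ L.chronFuture V
  past : ∃ B : Set X, S ⊆ L.chronPast B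

end Space

/-! ### Regions in submanifolds of a pseudo-Euclidean space -/

section Region

variable {W : Type*} [NormedAddCommGroup W] [NormedSpace ℝ W]

/-- Lipschitz curves `[0,1] → X` with future-directed timelike velocity almost everywhere. Here `B`
is the ambient bilinear form and the timelike vector field `T` gives the time orientation: a causal
vector `v` at `q` is future directed if `B (T q) v < 0`. -/
def IsTimelikeCurve (B : W → W → ℝ) (T : W → W) (X : Set W) (γ : ℝ → W) : Prop :=
  (∃ C, LipschitzOnWith C γ (Icc 0 1)) ∧ (∀ s ∈ Icc (0 : ℝ) 1, γ s ∈ X) ∧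
    ∀ᵐ s ∂(volume.restrict (Icc (0 : ℝ) 1)),
      B (deriv γ s) (deriv γ s) < 0 ∧ B (T (γ s)) (deriv γ s) < 0

/-- Lipschitz curves `[0,1] → X` with future-directed causal velocity almost everywhere. -/
def IsCausalCurve (B : W → W → ℝ) (T : W → W) (X : Set W) (γ : ℝ → W) : Prop :=
  (∃ C, LipschitzOnWith C γ (Icc 0 1)) ∧ (∀ s ∈ Icc (0 : ℝ) 1, γ s ∈ X) ∧
    ∀ᵐ s ∂(volume.restrict (Icc (0 : ℝ) 1)),
      B (deriv γ s) (deriv γ s) ≤ 0 ∧ B (T (γ s)) (deriv γ s) < 0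

/-- Lorentzian length `∫₀¹ √(-B(γ', γ'))`. -/
def properTime (B : W → W → ℝ) (γ : ℝ → W) : ENNReal :=
  ∫⁻ s in Icc (0 : ℝ) 1, ENNReal.ofReal (Real.sqrt (-B (deriv γ s) (deriv γ s)))

/-- The region `X`, with the metric induced by `B`, as a measured Lorentzian space: causal relation
and time separation come from the causal and timelike curves inside `X`, and the measure is the
restriction of `μ`. -/
def regionSpace [MeasurableSpace W] (B : W → W → ℝ) (T : W → W) (μ : Measure W) (X : Set W) :
    Space X where
  le x y := x = y ∨ ∃ γ : ℝ → W, IsCausalCurve B T X γ ∧ γ 0 = x ∧ γ 1 = y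
  τ x y := ⨆ (γ : ℝ → W) (_ : IsTimelikeCurve B T X γ ∧ γ 0 = x ∧ γ 1 = y), properTime B γ
  vol := μ.comap Subtype.val

/-- `√|det (B(∂ᵢΦ, ∂ⱼΦ))|`, with the derivatives of `Φ` in the directions of the basis `b`. -/
def gramDensity {ι P : Type*} [Fintype ι] [DecidableEq ι] [NormedAddCommGroup P]
    [NormedSpace ℝ P] (B : W → W → ℝ) (b : ι → P) (Φ : P → W) (z : P) : ℝ :=
  Real.sqrt |(Matrix.of fun i j => B (fderiv ℝ Φ z (b i)) (fderiv ℝ Φ z (b j))).det|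

/-- The volume measure, for the metric induced by `B`, of the submanifold of `W` parametrized by the
injective map `Φ` on `D`; here `b` is a basis of the parameter space whose unit cube has volume one.
-/
def paramVolume {ι P : Type*} [Fintype ι] [DecidableEq ι] [NormedAddCommGroup P]
    [NormedSpace ℝ P] [MeasureSpace P] [MeasurableSpace W]
    (B : W → W → ℝ) (b : ι → P) (Φ : P → W) (D : Set P) : Measure W :=
  ((volume.restrict D).withDensity fun z => ENNReal.ofReal (gramDensity B b Φ z)).map Φ

end Region

/-! ### The comparison functions -/

/-- `𝔰_κ`: the solution of `f'' + κ f = 0`, `f 0 = 0`, `f' 0 = 1`. -/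
def sn (κ r : ℝ) : ℝ :=
  if 0 < κ then Real.sin (Real.sqrt κ * r) / Real.sqrt κ
  else if κ < 0 then Real.sinh (Real.sqrt (-κ) * r) / Real.sqrt (-κ)
  else r

/-- `𝔠_κ`: the derivative of `𝔰_κ`. -/
def cs (κ r : ℝ) : ℝ :=
  if 0 < κ then Real.cos (Real.sqrt κ * r)
  else if κ < 0 then Real.cosh (Real.sqrt (-κ) * r)
  else 1

/-- `𝔇_{K,N}(t) = 𝔰_{K/(N-1)}(t)^{-(N-1)} ∫₀ᵗ 𝔰_{K/(N-1)}(s)^{N-1} ds`. -/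
def DKN (K : ℝ) (N : ℕ) (t : ℝ) : ℝ :=
  1 / sn (K / ((N : ℝ) - 1)) t ^ (N - 1) * ∫ s in (0 : ℝ)..t, sn (K / ((N : ℝ) - 1)) s ^ (N - 1)

/-! ### Minkowski space -/

/-- `ℝⁿ` with its Euclidean structure. -/
abbrev Euc (n : ℕ) := EuclideanSpace ℝ (Fin n)

/-- Points `(x, t)` of the `(n+1)`-dimensional Minkowski space. -/
abbrev Mink (n : ℕ) := Euc n × ℝ

/-- `x · x' - t t'`. -/
def minkForm (n : ℕ) (u v : Mink n) : ℝ := inner ℝ u.1 v.1 - u.2 * v.2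

/-- Time orientation of Minkowski space: the vector field `∂_t`. -/
def minkTime (n : ℕ) : Mink n → Mink n := fun _ => (0, 1)

/-- The standard basis of `ℝⁿ`. -/
def eucBasis (n : ℕ) : Fin n → Euc n := fun i => EuclideanSpace.single i 1

/-- The future unit hyperboloid as a graph over `ℝⁿ`. -/
def hyp (n : ℕ) (x : Euc n) : Mink n := (x, Real.sqrt (1 + ‖x‖ ^ 2))

/-- The part `‖x‖ ≤ a` of the future unit hyperboloid. -/
def hypCap (n : ℕ) (a : ℝ) : Set (Mink n) :=
  {u | u.2 ^ 2 - ‖u.1‖ ^ 2 = 1 ∧ 0 < u.2 ∧ ‖u.1‖ ≤ a}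

/-- The solid cone `t ≥ ‖x‖ √(1 + a²) / a`. -/
def minkCone (n : ℕ) (a : ℝ) : Set (Mink n) :=
  {y | ‖y.1‖ * Real.sqrt (1 + a ^ 2) / a ≤ y.2}

/-- The solid cone in Minkowski space as a measured Lorentzian space, with Lebesgue measure. -/
def minkSpace (n : ℕ) (a : ℝ) : Space (minkCone n a) :=
  regionSpace (minkForm n) (minkTime n) volume (minkCone n a)

/-- The origin. -/
def minkTip (n : ℕ) (a : ℝ) : Set (minkCone n a) := {q | (q : Mink n) = 0}

/-- The part in the cone of the hyperboloid `t² - ‖x‖² = ρ²`. -/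
def minkSlice (n : ℕ) (a ρ : ℝ) : Set (minkCone n a) :=
  {q | (q : Mink n).2 ^ 2 - ‖(q : Mink n).1‖ ^ 2 = ρ ^ 2}

/-- The `n`-dimensional area of `minkSlice n a ρ` for the induced Riemannian metric, computed in its
parametrization `x ↦ ρ (x, √(1 + ‖x‖²))`, `‖x‖ ≤ a`. -/
def minkSliceArea (n : ℕ) (a ρ : ℝ) : ENNReal :=
  paramVolume (minkForm n) (eucBasis n) (fun x => ρ • hyp n x) (Metric.closedBall 0 a)
    (Subtype.val '' minkSlice n a ρ)

/-! ### De Sitter and anti-de Sitter spaces -/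

/-- Points `(x, t, w)` of the ambient space `ℝⁿ × ℝ × ℝ`. -/
abbrev Amb (n : ℕ) := Euc n × ℝ × ℝ

/-- `x · x' - t t' + w w'`. -/
def dSForm (n : ℕ) (u v : Amb n) : ℝ := inner ℝ u.1 v.1 - u.2.1 * v.2.1 + u.2.2 * v.2.2

/-- `x · x' - t t' - w w'`. -/
def adSForm (n : ℕ) (u v : Amb n) : ℝ := inner ℝ u.1 v.1 - u.2.1 * v.2.1 - u.2.2 * v.2.2

/-- The `(n+1)`-dimensional de Sitter space of constant sectional curvature `k > 0`. -/
def deSitter (n : ℕ) (k : ℝ) : Set (Amb n) := {q | dSForm n q q = 1 / k}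

/-- The `(n+1)`-dimensional anti-de Sitter space of constant sectional curvature `k < 0`. -/
def antiDeSitter (n : ℕ) (k : ℝ) : Set (Amb n) := {q | adSForm n q q = 1 / k}

/-- Time orientation of de Sitter space: `∂_t` (whose inner product with a tangent vector is that of
its projection to the tangent space). -/
def dSTime (n : ℕ) : Amb n → Amb n := fun _ => (0, 1, 0)

/-- Time orientation of anti-de Sitter space: the rotation field `w ∂_t - t ∂_w`. -/
def adSTime (n : ℕ) : Amb n → Amb n := fun q => (0, q.2.2, -q.2.1)

/-- `exp_p (r u)` for the base point `p = (0, 0, 1/√|κ|)` of the de Sitter (`κ < 0`) or anti-de Sitter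
(`κ > 0`) space of sectional curvature `-κ` and a unit timelike vector `u`, tangent at `p`:
this is `𝔠_κ(r) p + 𝔰_κ(r) u`. -/
def expPt (n : ℕ) (κ r : ℝ) (u : Mink n) : Amb n :=
  (sn κ r • u.1, sn κ r * u.2, cs κ r / Real.sqrt |κ|)

/-- The radii `r` with `0 < r < T_κ`, where `T_κ` is the first positive zero of `𝔰_κ`
(`∞` if there is none). -/
def radii (κ : ℝ) : Set ℝ := {r | 0 < r ∧ (0 < κ → r < Real.pi / Real.sqrt κ)}

/-- The conical region of the quadric `Q` with tip `p` spanned by the geodesics issuing from `p` in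
the directions of `hypCap n a`, up to the first conjugate point if there is one. -/
def quadricCone (n : ℕ) (Q : Set (Amb n)) (κ a : ℝ) : Set (Amb n) :=
  {q ∈ Q | ∃ r, (r = 0 ∨ r ∈ radii κ) ∧ ∃ u ∈ hypCap n a, q = expPt n κ r u}

/-- The standard basis of `ℝ × ℝⁿ`. -/
def polarBasis (n : ℕ) : Unit ⊕ Fin n → ℝ × Euc n :=
  Sum.elim (fun _ => (1, 0)) (fun i => (0, eucBasis n i))

/-- The volume measure of the quadric on `{exp_p (r u)}`, `r` in `radii κ`, `u` a future unit
timelike vector, written in the geodesic polar coordinates `(r, x) ↦ exp_p (r (x, √(1 + ‖x‖²)))`. -/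
def quadricVolume (n : ℕ) (B : Amb n → Amb n → ℝ) (κ : ℝ) : Measure (Amb n) :=
  paramVolume B (polarBasis n) (fun z => expPt n κ z.1 (hyp n z.2)) (radii κ ×ˢ univ)

/-- A conical region in anti-de Sitter space of sectional curvature `-κ < 0`. -/
def adSSpace (n : ℕ) (κ a : ℝ) : Space (quadricCone n (antiDeSitter n (-κ)) κ a) :=
  regionSpace (adSForm n) (adSTime n) (quadricVolume n (adSForm n) κ) _

/-- A conical region in de Sitter space of sectional curvature `-κ > 0`. -/
def dSSpace (n : ℕ) (κ a : ℝ) : Space (quadricCone n (deSitter n (-κ)) κ a) :=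
  regionSpace (dSForm n) (dSTime n) (quadricVolume n (dSForm n) κ) _

/-- The tip `p` of the conical region. -/
def quadricTip (n : ℕ) (Q : Set (Amb n)) (κ a : ℝ) : Set (quadricCone n Q κ a) :=
  {q | (q : Amb n) = (0, 0, 1 / Real.sqrt |κ|)}

/-- The points `exp_p (ρ u)`, `u ∈ hypCap n a`, of the conical region. -/
def quadricSlice (n : ℕ) (Q : Set (Amb n)) (κ a ρ : ℝ) : Set (quadricCone n Q κ a) :=
  {q | ∃ u ∈ hypCap n a, (q : Amb n) = expPt n κ ρ u}

/-- The `n`-dimensional area of `quadricSlice n Q κ a ρ` for the Riemannian metric induced by `B`,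
computed in its parametrization `x ↦ exp_p (ρ (x, √(1 + ‖x‖²)))`, `‖x‖ ≤ a`. -/
def quadricSliceArea (n : ℕ) (B : Amb n → Amb n → ℝ) (Q : Set (Amb n)) (κ a ρ : ℝ) : ENNReal :=
  paramVolume B (eucBasis n) (fun x => expPt n κ ρ (hyp n x)) (Metric.closedBall 0 a)
    (Subtype.val '' quadricSlice n Q κ a ρ)

/-- The pair `(V, S)` is admissible, `S` lies at distance `ρ` from `V`, the area of `S`, i.e. its
future Minkowski content, is `A`, and nontrivial equality holds in the isoperimetric-type inequality
`𝔪⁺(S) 𝔇_{K,N}(dist(V,S)) ≤ 𝔪(C(V,S))`. -/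
structure AttainsEquality {X : Type*} [TopologicalSpace X] [MeasurableSpace X] (L : Space X)
    (K : ℝ) (N : ℕ) (V S : Set X) (ρ : ℝ) (A : ENNReal) : Prop where
  admissible : L.Admissible V S
  dist_eq : L.dist V S = (ρ : EReal)
  content_eq_area : L.minkowskiContent S = A
  vol_pos : 0 < L.vol (L.cone V S)
  vol_lt_top : L.vol (L.cone V S) < ⊤
  equality :
    L.minkowskiContent S * ENNReal.ofReal (DKN K N (L.dist V S).toReal) = L.vol (L.cone V S)

end LorentzIsop

end

open Set Filter Topology MeasureTheory

noncomputable section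

namespace LorentzIsop

section

/-! ### Monotone functions along causal curves -/

/-! Each region is a Lorentzian cone over a hyperbolic ball: in geodesic polar coordinates about the
tip the metric is `-dr² + 𝔰_κ(r)² g_ℍ`, and everything in the inequality can be computed from the
radius `r`.

The key fact is that `r` is a steep time function. By the reverse Cauchy–Schwarz inequality, a
future causal velocity `v` satisfies `√(-B(v,v)) ≤ dr(v)`. Integrating along curves gives `τ(x,y) ≤
r(y) - r(x)` (`IsRadius.properTime_le`). Radial lines stay in the region and attain this bound
(`IsPolarChart.ofReal_sub_le_properTime`). The same monotonicity makes level sets of `r` acausal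
(`IsRadius.lt_of_causal`).

Consequently `τ_V = r` off the tip. In the future of the level `S = {r = ρ}` one has `τ_S = r - ρ`,
so the points with `0 < τ_S < ε` form the shell `ρ < r < ρ + ε`. Moreover `C(V,S) = {r ≤ ρ}`
(`PolarModel.cone_eq`). The measure is `ω 𝔰_κ(r)ⁿ dr` in the radius, where `ω` is the hyperbolic
volume of the cap. Thus `𝔪(C(V,S)) = ω ∫₀^ρ 𝔰_κⁿ`, while the content of `S` is the derivative `ω
𝔰_κ(ρ)ⁿ` of this volume, which is also the area of `S`. Multiplying by `𝔇_{K,N}(ρ)` cancels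
`𝔰_κ(ρ)ⁿ` and leaves equality (`PolarModel.attainsEquality`).

What depends on the model is the gradient inequality and the volume formula. The radius is singular
at the tip, so it is written `ψ ∘ g` with `g` smooth on the ambient vector space: `g = t² - ‖x‖²` in
Minkowski space, `g = -w` in anti-de Sitter space and `g = w` in de Sitter space. The two quadrics
share one computation with the form `ambForm n σ`, `σ |κ| = -κ`. The Minkowski volume is Lebesgue
measure, so its polar form is derived separately in `volume_minkCone_radii`. -/

theorem _root_.AbsolutelyContinuousOnInterval.monotoneOn_of_deriv_nonneg {f : ℝ → ℝ} {a b : ℝ}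
    (hf : AbsolutelyContinuousOnInterval f a b) (hab : a ≤ b)
    (h : ∀ᵐ s ∂(volume.restrict (Icc a b)), 0 ≤ deriv f s) : MonotoneOn f (Icc a b) := by
  intro x hx y hy hxy
  have h1 : AbsolutelyContinuousOnInterval f x y := hf.mono <| by
    rw [uIcc_of_le hab, uIcc_of_le hxy]; exact Icc_subset_Icc hx.1 hy.2
  have h2 := h1.integral_deriv_eq_sub
  have h3 : 0 ≤ ∫ s in x..y, deriv f s := by
    apply intervalIntegral.integral_nonneg_of_ae_restrict hxy
    exact ae_restrict_of_ae_restrict_of_subset (Icc_subset_Icc hx.1 hy.2) h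
  linarith

/-- Only an inequality, since a monotone function may have a singular part; it is the direction
needed. It applies to `ψ ∘ g ∘ γ`, whose absolute continuity is not evident because `ψ` has a
square-root singularity at the tip in all three models. -/
theorem _root_.MonotoneOn.lintegral_deriv_le {f : ℝ → ℝ} {a b : ℝ} (hab : a ≤ b)
    (hf : MonotoneOn f (Icc a b)) :
    ∫⁻ s in Icc a b, ENNReal.ofReal (deriv f s) ≤ ENNReal.ofReal (f b - f a) := by
  have hf' : MonotoneOn f (uIcc a b) := by rwa [uIcc_of_le hab]
  have h0 : 0 ≤ f b - f a := sub_nonneg.2 (hf ⟨le_rfl, hab⟩ ⟨hab, le_rfl⟩ hab)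
  have h1 := hf'.intervalIntegral_deriv_mem_uIcc
  rw [uIcc_of_le h0] at h1
  have h2 := hf'.intervalIntegrable_deriv
  rw [intervalIntegrable_iff_integrableOn_Icc_of_le hab] at h2
  rw [intervalIntegral.integral_of_le hab, ← integral_Icc_eq_integral_Ioc] at h1
  have h3 : ∀ᵐ s ∂(volume.restrict (Icc a b)), 0 ≤ deriv f s := by
    have : ∀ᵐ s ∂(volume.restrict (Ioo a b)), 0 ≤ deriv f s := by
      filter_upwards [ae_restrict_mem measurableSet_Ioo] with s hs
      have hm : (Icc a b) ∈ 𝓝 s := Icc_mem_nhds hs.1 hs.2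
      rw [← derivWithin_of_mem_nhds hm]
      exact hf.derivWithin_nonneg
    rwa [restrict_Ioo_eq_restrict_Icc] at this
  rw [← ofReal_integral_eq_lintegral_ofReal h2 h3]
  exact ENNReal.ofReal_le_ofReal h1.2

/-! ### Radius functions and the upper bound for the length of curves -/

section Curves

variable {W : Type*} [NormedAddCommGroup W] [NormedSpace ℝ W]

theorem _root_.ContDiff.absolutelyContinuousOnInterval_comp {g : W → ℝ} (hg : ContDiff ℝ 1 g)
    {γ : ℝ → W} {C : NNReal} {a b : ℝ} (hab : a ≤ b) (hγ : LipschitzOnWith C γ (Icc a b)) :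
    AbsolutelyContinuousOnInterval (g ∘ γ) a b := by
  have hc : IsCompact (γ '' Icc a b) := isCompact_Icc.image_of_continuousOn hγ.continuousOn
  obtain ⟨D, hD⟩ := LocallyLipschitzOn.exists_lipschitzOnWith_of_compact hc
    (hg.locallyLipschitz.locallyLipschitzOn)
  have h : LipschitzOnWith (D * C) (g ∘ γ) (uIcc a b) := by
    rw [uIcc_of_le hab]
    exact hD.comp hγ (mapsTo_image _ _)
  exact h.absolutelyContinuousOnInterval

/-- A time function `ψ ∘ g` on `X`, smooth away from the minimum point `p`, whose gradient satisfies
the reverse Cauchy–Schwarz inequality. -/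
structure IsRadius (B : W → W → ℝ) (T : W → W) (X : Set W) (p : W) (g : W → ℝ) (ψ ψ' : ℝ → ℝ) :
    Prop where
  form_zero : ∀ q, B q 0 = 0
  contDiff : ContDiff ℝ 1 g
  strictMono : StrictMonoOn ψ (g '' X)
  hasDerivAt : ∀ q ∈ X, q ≠ p → HasDerivAt ψ (ψ' (g q)) (g q)
  lt_of_ne : ∀ q ∈ X, q ≠ p → g p < g q
  tip_mem : p ∈ X
  grad : ∀ (γ : ℝ → W) (s : ℝ) (v : W), (∀ᶠ s' in 𝓝 s, γ s' ∈ X) → HasDerivAt γ v s → γ s ≠ p →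
    B v v ≤ 0 → B (T (γ s)) v < 0 →
    0 < fderiv ℝ g (γ s) v ∧ Real.sqrt (-B v v) ≤ ψ' (g (γ s)) * fderiv ℝ g (γ s) v

namespace IsRadius

variable {B : W → W → ℝ} {T : W → W} {X : Set W} {p : W} {g : W → ℝ} {ψ ψ' : ℝ → ℝ}
  (H : IsRadius B T X p g ψ ψ') {γ : ℝ → W}

include H

theorem hasDerivAt_comp {v : W} {s : ℝ} (h : HasDerivAt γ v s) :
    HasDerivAt (g ∘ γ) (fderiv ℝ g (γ s) v) s :=
  ((H.contDiff.differentiable one_ne_zero (γ s)).hasFDerivAt).comp_hasDerivAt s h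

theorem min_le {q : W} (hq : q ∈ X) : g p ≤ g q := by
  by_cases h : q = p
  · rw [h]
  · exact (H.lt_of_ne q hq h).le

/-- At a point of non-differentiability `deriv` takes the default value `0`, which the strict
inequality excludes. -/
theorem differentiableAt_of_future {q : W} {s : ℝ} (h : B q (deriv γ s) < 0) :
    HasDerivAt γ (deriv γ s) s := by
  refine (?_ : DifferentiableAt ℝ γ s).hasDerivAt
  by_contra hd
  rw [deriv_zero_of_not_differentiableAt hd, H.form_zero] at h
  exact lt_irrefl _ h

/-- The gradient bound is not available at the tip, but there `g ∘ γ` has a local minimum and its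
derivative vanishes. -/
theorem deriv_nonneg {s : ℝ} (hX : ∀ s ∈ Icc (0 : ℝ) 1, γ s ∈ X) (hs : s ∈ Ioo (0 : ℝ) 1)
    (h1 : B (deriv γ s) (deriv γ s) ≤ 0) (h2 : B (T (γ s)) (deriv γ s) < 0) :
    0 ≤ deriv (g ∘ γ) s := by
  have hd := H.differentiableAt_of_future h2
  have hX' : ∀ᶠ s' in 𝓝 s, γ s' ∈ X := by
    filter_upwards [Icc_mem_nhds hs.1 hs.2] with s' hs' using hX s' hs'
  by_cases hp : γ s = p
  · have : IsLocalMin (g ∘ γ) s := by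
      filter_upwards [hX'] with s' hs'
      simp only [Function.comp, hp]
      exact H.min_le hs'
    rw [this.deriv_eq_zero]
  · rw [(H.hasDerivAt_comp hd).deriv]
    exact (H.grad γ s _ hX' hd hp h1 h2).1.le

theorem monotoneOn (hγ : IsCausalCurve B T X γ) : MonotoneOn (g ∘ γ) (Icc 0 1) := by
  obtain ⟨⟨C, hC⟩, hX, hae⟩ := hγ
  refine (H.contDiff.absolutelyContinuousOnInterval_comp zero_le_one hC).monotoneOn_of_deriv_nonneg
    zero_le_one ?_
  rw [← restrict_Ioo_eq_restrict_Icc] at hae ⊢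
  filter_upwards [hae, ae_restrict_mem measurableSet_Ioo] with s h hs
  exact H.deriv_nonneg hX hs h.1 h.2

/-- If the end values agreed, monotonicity would make `g ∘ γ` constant. Starting at the tip, the
curve would then end there, as `p` is the only minimum point. Starting elsewhere, it would avoid the
tip, and almost everywhere on `(0,1)` the derivative of `g ∘ γ` would be both zero and positive. -/
theorem lt_of_causal (hγ : IsCausalCurve B T X γ) (hne : γ 0 ≠ γ 1) :
    ψ (g (γ 0)) < ψ (g (γ 1)) := by
  have hm := H.monotoneOn hγ
  obtain ⟨⟨C, hC⟩, hX, hae⟩ := hγ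
  have h0 : (0 : ℝ) ∈ Icc (0 : ℝ) 1 := by simp
  have h1 : (1 : ℝ) ∈ Icc (0 : ℝ) 1 := by simp
  refine H.strictMono (mem_image_of_mem _ (hX 0 h0)) (mem_image_of_mem _ (hX 1 h1)) ?_
  refine lt_of_le_of_ne (hm h0 h1 zero_le_one) fun he => hne ?_
  have hconst : ∀ s ∈ Icc (0 : ℝ) 1, g (γ s) = g (γ 0) := fun s hs =>
    le_antisymm ((hm hs h1 hs.2).trans_eq he.symm) (hm h0 hs hs.1)
  by_cases hp : γ 0 = p
  · by_contra hne'
    have := H.lt_of_ne _ (hX 1 h1) (fun h => hne' (hp.trans h.symm))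
    rw [← hp] at this
    exact absurd he this.ne
  · exfalso
    rw [← restrict_Ioo_eq_restrict_Icc] at hae
    have : ∀ᵐ s ∂(volume.restrict (Ioo (0 : ℝ) 1)), False := by
      filter_upwards [hae, ae_restrict_mem measurableSet_Ioo] with s h hs
      have hd := H.differentiableAt_of_future h.2
      have hX' : ∀ᶠ s' in 𝓝 s, γ s' ∈ X := by
        filter_upwards [Icc_mem_nhds hs.1 hs.2] with s' hs' using hX s' hs'
      have hsp : γ s ≠ p := by
        intro hsp
        have h3 := hconst s (Ioo_subset_Icc_self hs)
        rw [hsp] at h3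
        exact (H.lt_of_ne _ (hX 0 h0) hp).ne h3
      have h4 := (H.grad γ s _ hX' hd hsp h.1 h.2).1
      have h5 : HasDerivAt (g ∘ γ) 0 s := by
        refine (hasDerivAt_const s (g (γ 0))).congr_of_eventuallyEq ?_
        filter_upwards [Icc_mem_nhds hs.1 hs.2] with s' hs' using hconst s' hs'
      exact h4.ne' ((H.hasDerivAt_comp hd).unique h5)
    have h6 : (ae (volume.restrict (Ioo (0 : ℝ) 1))).NeBot := by
      rw [ae_restrict_neBot]
      simp
    exact h6.ne (Filter.eventually_false_iff_eq_bot.1 this)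

theorem properTime_le (hγ : IsTimelikeCurve B T X γ) :
    properTime B γ ≤ ENNReal.ofReal (ψ (g (γ 1)) - ψ (g (γ 0))) := by
  have hγ' : IsCausalCurve B T X γ :=
    ⟨hγ.1, hγ.2.1, hγ.2.2.mono fun s h => ⟨h.1.le, h.2⟩⟩
  have hm := H.monotoneOn hγ'
  obtain ⟨-, hX, hae⟩ := hγ'
  have h0 : (0 : ℝ) ∈ Icc (0 : ℝ) 1 := by simp
  have hm' : MonotoneOn (ψ ∘ g ∘ γ) (Icc 0 1) := fun s hs t ht hst =>
    H.strictMono.monotoneOn (mem_image_of_mem _ (hX s hs)) (mem_image_of_mem _ (hX t ht))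
      (hm hs ht hst)
  refine le_trans (lintegral_mono_ae ?_) (hm'.lintegral_deriv_le zero_le_one)
  rw [← restrict_Ioo_eq_restrict_Icc] at hae ⊢
  filter_upwards [hae, ae_restrict_mem measurableSet_Ioo] with s h hs
  apply ENNReal.ofReal_le_ofReal
  have hd := H.differentiableAt_of_future h.2
  have hX' : ∀ᶠ s' in 𝓝 s, γ s' ∈ X := by
    filter_upwards [Icc_mem_nhds hs.1 hs.2] with s' hs' using hX s' hs'
  by_cases hsp : γ s = p
  · exfalso
    -- A visit to the tip at an interior time `s` forces the curve to rest there on `[0, s]`, since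
    -- `g ∘ γ` is monotone and `p` is its strict minimum. The left derivative at `s` is then zero,
    -- against the timelike velocity.
    have hc : ∀ s' ∈ Icc 0 s, γ s' = p := by
      intro s' hs'
      have hs'' : s' ∈ Icc (0 : ℝ) 1 := ⟨hs'.1, hs'.2.trans hs.2.le⟩
      by_contra hne
      have h3 := H.lt_of_ne _ (hX s' hs'') hne
      have h4 : g (γ s') ≤ g (γ s) := hm hs'' (Ioo_subset_Icc_self hs) hs'.2
      rw [hsp] at h4
      exact absurd h3 h4.not_gt
    have hu : UniqueDiffWithinAt ℝ (Icc 0 s) s :=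
      uniqueDiffOn_Icc hs.1 s ⟨hs.1.le, le_rfl⟩
    have h5 : HasDerivWithinAt γ 0 (Icc 0 s) s :=
      (hasDerivWithinAt_const s _ p).congr hc (hc s ⟨hs.1.le, le_rfl⟩)
    have h6 := hu.eq_deriv _ hd.hasDerivWithinAt h5
    have h7 := h.2
    rw [h6, H.form_zero] at h7
    exact lt_irrefl _ h7
  · have h4 := (H.grad γ s _ hX' hd hsp h.1 h.2).2
    have h5 : HasDerivAt (ψ ∘ g ∘ γ) _ s :=
      (H.hasDerivAt _ (hX s (Ioo_subset_Icc_self hs)) hsp).comp s (H.hasDerivAt_comp hd)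
    rw [h5.deriv]
    exact h4

end IsRadius

end Curves

end

section

/-! ### The comparison functions -/

theorem continuous_sn (κ : ℝ) : Continuous (sn κ) := by
  unfold sn
  split_ifs <;> fun_prop

theorem sn_pos {κ r : ℝ} (hr : r ∈ radii κ) : 0 < sn κ r := by
  obtain ⟨h0, h1⟩ := hr
  unfold sn
  split_ifs with h h'
  · have hk : 0 < Real.sqrt κ := Real.sqrt_pos.2 h
    refine div_pos (Real.sin_pos_of_pos_of_lt_pi (by positivity) ?_) hk
    have := (lt_div_iff₀ hk).1 (h1 h)
    linarith
  · have hk : 0 < Real.sqrt (-κ) := Real.sqrt_pos.2 (by linarith)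
    exact div_pos (Real.sinh_pos_iff.2 (by positivity)) hk
  · exact h0

theorem sn_zero (κ : ℝ) : sn κ 0 = 0 := by
  unfold sn
  split_ifs <;> simp

theorem mem_radii_of_le {κ r r' : ℝ} (hr : r ∈ radii κ) (h0 : 0 < r') (h : r' ≤ r) :
    r' ∈ radii κ := ⟨h0, fun hκ => h.trans_lt (hr.2 hκ)⟩

theorem mem_insert_radii_of_le {κ r r' : ℝ} (hr : r ∈ radii κ) (h0 : 0 ≤ r') (h : r' ≤ r) :
    r' ∈ insert 0 (radii κ) := by
  rcases h0.eq_or_lt with h0 | h0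
  · exact Or.inl h0.symm
  · exact Or.inr (mem_radii_of_le hr h0 h)

theorem nonneg_of_mem_insert_radii {κ r : ℝ} (hr : r ∈ insert 0 (radii κ)) : 0 ≤ r := by
  rcases hr with rfl | hr
  · exact le_rfl
  · exact hr.1.le

theorem isOpen_radii (κ : ℝ) : IsOpen (radii κ) := by
  by_cases h : 0 < κ
  · have : radii κ = Ioo 0 (Real.pi / Real.sqrt κ) := by
      ext r; simp [radii, h]
    rw [this]; exact isOpen_Ioo
  · have : radii κ = Ioi 0 := by
      ext r; simp [radii, h]
    rw [this]; exact isOpen_Ioi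

theorem eventually_Icc_subset_radii {κ ρ : ℝ} (hρ : ρ ∈ radii κ) :
    ∀ᶠ ε in 𝓝[>] (0 : ℝ), Icc ρ (ρ + ε) ⊆ radii κ := by
  have h1 : ∀ᶠ ε in 𝓝 (0 : ℝ), ρ + ε ∈ radii κ := by
    have : Tendsto (fun ε : ℝ => ρ + ε) (𝓝 0) (𝓝 ρ) := by
      simpa using (continuous_const_add ρ).tendsto 0
    exact this.eventually ((isOpen_radii κ).mem_nhds hρ)
  filter_upwards [nhdsWithin_le_nhds h1] with ε hε r hr
  exact mem_radii_of_le hε (hρ.1.trans_le hr.1) hr.2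

theorem lintegral_sn_pow {κ r r' : ℝ} (hr : 0 ≤ r) (h : r ≤ r') (hr' : r' ∈ radii κ) (n : ℕ) :
    ∫⁻ s in Ioc r r', ENNReal.ofReal (sn κ s ^ n) =
      ENNReal.ofReal (∫ s in r..r', sn κ s ^ n) := by
  rw [intervalIntegral.integral_of_le h, ofReal_integral_eq_lintegral_ofReal]
  · exact (((continuous_sn κ).pow n).integrableOn_Icc (a := r) (b := r')).mono_set Ioc_subset_Icc_self
  · filter_upwards [ae_restrict_mem measurableSet_Ioc] with s hs
    exact pow_nonneg (sn_pos (mem_radii_of_le hr' (hr.trans_lt hs.1) hs.2)).le n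

theorem sum_succ_sub_castSucc {k : ℕ} (t : Fin (k + 1) → ℝ) :
    ∑ i : Fin k, (t i.succ - t i.castSucc) = t (Fin.last k) - t 0 := by
  induction k with
  | zero => simp
  | succ k ih =>
    rw [Fin.sum_univ_castSucc]
    have := ih fun i => t i.castSucc
    simp only [Fin.succ_castSucc, Fin.castSucc_zero] at this ⊢
    rw [this, Fin.succ_last]
    ring

/-! ### Spaces with geodesic polar coordinates -/

/-- Polar coordinates `E r x`, with `r` in `[0, T_κ)` and `x` in the compact set `D`, in which
radial lines realize the radius difference, an upper bound for the time separation, and the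
measure is `𝔰_κ(r)ⁿ dr` times a measure of total mass `ω`. -/
structure PolarModel {X P : Type*} [TopologicalSpace X] [MeasurableSpace X] [TopologicalSpace P]
    (L : Space X) (n : ℕ) (κ : ℝ) (D : Set P) (ω : ENNReal) (rad : X → ℝ) (E : ℝ → P → X) :
    Prop where
  compact : IsCompact D
  nonempty : D.Nonempty
  surj : ∀ q, ∃ r ∈ insert 0 (radii κ), ∃ x ∈ D, E r x = q
  rad_E : ∀ r ∈ insert 0 (radii κ), ∀ x ∈ D, rad (E r x) = r
  tip : ∀ x ∈ D, ∀ y ∈ D, E 0 x = E 0 y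
  cont : ContinuousOn (fun z : ℝ × P => E z.1 z.2) (insert 0 (radii κ) ×ˢ D)
  rad_lt : ∀ q q', L.le q q' → q ≠ q' → rad q < rad q'
  τ_le : ∀ q q', L.τ q q' ≤ ENNReal.ofReal (rad q' - rad q)
  le_τ : ∀ r ∈ insert 0 (radii κ), ∀ r' ∈ insert 0 (radii κ), r < r' → ∀ x ∈ D,
    ENNReal.ofReal (r' - r) ≤ L.τ (E r x) (E r' x)
  vol : ∀ J ⊆ radii κ, MeasurableSet J →
    L.vol {q | rad q ∈ J} = ω * ∫⁻ r in J, ENNReal.ofReal (sn κ r ^ n)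
  vol_tip : L.vol {q | rad q = 0} = 0
  ω_ne_zero : ω ≠ 0
  ω_ne_top : ω ≠ ⊤

namespace PolarModel

variable {X P : Type*} [TopologicalSpace X] [MeasurableSpace X] [TopologicalSpace P]
  {L : Space X} {n : ℕ} {κ : ℝ} {D : Set P} {ω : ENNReal} {rad : X → ℝ} {E : ℝ → P → X}
  (H : PolarModel L n κ D ω rad E)
include H

theorem τ_eq {r r' : ℝ} (hr : r ∈ insert 0 (radii κ)) (hr' : r' ∈ insert 0 (radii κ))
    (h : r ≤ r') {x : P} (hx : x ∈ D) : L.τ (E r x) (E r' x) = ENNReal.ofReal (r' - r) := by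
  rcases h.eq_or_lt with rfl | h
  · have := H.τ_le (E r x) (E r x)
    simpa using this
  · refine le_antisymm ?_ (H.le_τ r hr r' hr' h x hx)
    have := H.τ_le (E r x) (E r' x)
    rwa [H.rad_E r hr x hx, H.rad_E r' hr' x hx] at this

theorem rad_lt_of_chron {q q' : X} (h : L.chron q q') : rad q < rad q' := by
  have := lt_of_lt_of_le h (H.τ_le q q')
  simpa using this

theorem rad_mem (q : X) : rad q ∈ insert 0 (radii κ) := by
  obtain ⟨r, hr, x, hx, rfl⟩ := H.surj q
  rwa [H.rad_E r hr x hx]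

theorem exists_eq (q : X) : ∃ x ∈ D, E (rad q) x = q := by
  obtain ⟨r, hr, x, hx, rfl⟩ := H.surj q
  exact ⟨x, hx, by rw [H.rad_E r hr x hx]⟩

theorem level_zero_subsingleton : {q | rad q = 0}.Subsingleton := by
  intro q hq q' hq'
  obtain ⟨x, hx, h⟩ := H.exists_eq q
  obtain ⟨x', hx', h'⟩ := H.exists_eq q'
  rw [hq] at h; rw [hq'] at h'
  rw [← h, ← h']; exact H.tip x hx x' hx'

theorem mem_chronFuture_level {c : ℝ} (hc : c ∈ insert 0 (radii κ)) {q : X} :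
    q ∈ L.chronFuture {q | rad q = c} ↔ c < rad q := by
  constructor
  · rintro ⟨y, hy, h⟩
    rw [← show rad y = c from hy]
    exact H.rad_lt_of_chron h
  · intro h
    obtain ⟨x, hx, hq⟩ := H.exists_eq q
    refine ⟨E c x, H.rad_E c hc x hx, ?_⟩
    unfold Space.chron
    rw [← hq, H.τ_eq hc (H.rad_mem q) h.le hx]
    simpa using h

theorem tauFrom_level {c : ℝ} (hc : c ∈ insert 0 (radii κ)) {q : X} (h : c < rad q) :
    L.tauFrom {q | rad q = c} q = ((rad q - c : ℝ) : EReal) := by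
  rw [Space.tauFrom, if_pos ((H.mem_chronFuture_level hc).2 h)]
  have : (⨆ y ∈ {q | rad q = c}, L.τ y q) = ENNReal.ofReal (rad q - c) := by
    apply le_antisymm
    · refine iSup₂_le fun y hy => ?_
      rw [← show rad y = c from hy]
      exact H.τ_le y q
    · obtain ⟨x, hx, hq⟩ := H.exists_eq q
      have h1 := H.τ_eq hc (H.rad_mem q) h.le hx
      rw [hq] at h1
      rw [← h1]
      exact le_iSup₂ (f := fun y _ => L.τ y q) (E c x) (H.rad_E c hc x hx)
  rw [this, EReal.coe_ennreal_ofReal, max_eq_left (by linarith)]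

theorem tauFrom_level_nonpos {c : ℝ} (hc : c ∈ insert 0 (radii κ)) {q : X} (h : rad q ≤ c) :
    L.tauFrom {q | rad q = c} q ≤ 0 := by
  rw [Space.tauFrom, if_neg (fun h' => h.not_gt ((H.mem_chronFuture_level hc).1 h'))]
  split_ifs
  · rw [EReal.neg_le_zero]
    exact EReal.coe_ennreal_nonneg _
  · exact le_rfl

theorem preimage_tauFrom_level {c : ℝ} (hc : c ∈ insert 0 (radii κ)) (ε : ℝ) :
    L.tauFrom {q | rad q = c} ⁻¹' Ioo (0 : EReal) (ε : EReal) = {q | rad q ∈ Ioo c (c + ε)} := by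
  ext q
  by_cases h : c < rad q
  · simp only [mem_preimage, H.tauFrom_level hc h, mem_Ioo, mem_ofPred_eq]
    rw [← EReal.coe_zero, EReal.coe_lt_coe_iff, EReal.coe_lt_coe_iff]
    constructor <;> rintro ⟨h1, h2⟩ <;> constructor <;> linarith
  · have h1 := H.tauFrom_level_nonpos hc (not_lt.1 h)
    simp only [mem_preimage, mem_Ioo, mem_ofPred_eq, h, false_and, iff_false, not_and]
    exact fun h2 => absurd h2 h1.not_gt

theorem level_eq_image {c : ℝ} (hc : c ∈ insert 0 (radii κ)) : {q | rad q = c} = E c '' D := by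
  ext q
  constructor
  · rintro rfl
    obtain ⟨x, hx, h⟩ := H.exists_eq q
    exact ⟨x, hx, h⟩
  · rintro ⟨x, hx, rfl⟩
    exact H.rad_E c hc x hx

theorem continuousOn_level {c : ℝ} (hc : c ∈ insert 0 (radii κ)) : ContinuousOn (E c) D :=
  H.cont.comp (f := fun x => (c, x)) (by fun_prop) fun _ hx => ⟨hc, hx⟩

theorem isCompact_level {c : ℝ} (hc : c ∈ insert 0 (radii κ)) : IsCompact {q | rad q = c} := by
  rw [H.level_eq_image hc]
  exact H.compact.image_of_continuousOn (H.continuousOn_level hc)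

theorem exists_mem_level {c : ℝ} (hc : c ∈ insert 0 (radii κ)) : ∃ q, rad q = c := by
  obtain ⟨x, hx⟩ := H.nonempty
  exact ⟨E c x, H.rad_E c hc x hx⟩

theorem admissible [T1Space X] [MeasurableSingletonClass X] {ρ : ℝ} (hρ : ρ ∈ radii κ) :
    L.Admissible {q | rad q = 0} {q | rad q = ρ} where
  borel := H.level_zero_subsingleton.measurableSet
  achronal x hx y hy h := by
    have := H.rad_lt_of_chron h
    rw [show rad x = 0 from hx, show rad y = 0 from hy] at this
    exact lt_irrefl _ this
  timelikeComplete := by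
    -- `V` is a single point, so each of the sets in question is closed and finite, whatever the
    -- causal relation.
    have key : ∀ A : Set X, IsCompact (closure (A ∩ {q | rad q = 0})) ∧
        closure (A ∩ {q | rad q = 0}) ⊆ {q | rad q = 0} := by
      intro A
      have h : (A ∩ {q | rad q = 0}).Subsingleton :=
        H.level_zero_subsingleton.anti inter_subset_right
      rw [h.isClosed.closure_eq]
      exact ⟨h.finite.isCompact, inter_subset_right⟩
    exact ⟨fun _ _ => key _, fun _ _ => key _⟩
  compact := H.isCompact_level (Or.inr hρ)
  acausal x hx y hy h := by
    by_contra hne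
    have := H.rad_lt x y h hne
    rw [show rad x = ρ from hx, show rad y = ρ from hy] at this
    exact lt_irrefl _ this
  future q hq := by
    rw [H.mem_chronFuture_level (Or.inl rfl), show rad q = ρ from hq]
    exact hρ.1
  past := by
    obtain ⟨ε, h1, h2⟩ := ((eventually_Icc_subset_radii hρ).and self_mem_nhdsWithin).exists
    have h2 : 0 < ε := h2
    -- The set of radii is open, so each radial line continues a little beyond `ρ`; this puts `S` in
    -- the past of the whole space.
    refine ⟨univ, fun q hq => ?_⟩
    obtain ⟨x, hx, h⟩ := H.exists_eq q
    rw [show rad q = ρ from hq] at h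
    refine ⟨E (ρ + ε) x, mem_univ _, ?_⟩
    unfold Space.chron
    rw [← h, H.τ_eq (Or.inr hρ) (Or.inr (h1 ⟨by linarith, le_rfl⟩)) (by linarith) hx]
    simpa using h2

theorem dist_eq {ρ : ℝ} (hρ : ρ ∈ radii κ) :
    L.dist {q | rad q = 0} {q | rad q = ρ} = (ρ : EReal) := by
  have h : ∀ q, rad q = ρ → L.tauFrom {q | rad q = 0} q = (ρ : EReal) := by
    intro q hq
    rw [H.tauFrom_level (Or.inl rfl) (by rw [hq]; exact hρ.1), hq, sub_zero]
  obtain ⟨q, hq⟩ := H.exists_mem_level (Or.inr hρ)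
  apply le_antisymm
  · exact (iInf₂_le q hq).trans (h q hq).le
  · exact le_iInf₂ fun q hq => (h q hq).ge

/-- Tube lemma for the compact set `D` of directions. It makes the infimum over neighbourhoods in
the Minkowski content irrelevant: for small `ε` the shell already lies in `U`. -/
theorem eventually_subset_of_isOpen {ρ : ℝ} (hρ : ρ ∈ radii κ) {U : Set X} (hU : IsOpen U)
    (hS : {q | rad q = ρ} ⊆ U) :
    ∀ᶠ ε in 𝓝[>] (0 : ℝ), {q | rad q ∈ Ioo ρ (ρ + ε)} ⊆ U := by
  -- The repeated membership is deliberate: `E` is continuous only relative to `D`, while the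
  -- compactness argument needs a predicate holding on full neighbourhoods of `(ρ, x)`.
  have h2 : ∀ᶠ r in 𝓝 ρ, ∀ x ∈ D, x ∈ D → E r x ∈ U := by
    refine H.compact.eventually_forall_of_forall_eventually fun x hx => ?_
    have hm : U ∈ 𝓝 (E ρ x) := hU.mem_nhds (hS (H.rad_E ρ (Or.inr hρ) x hx))
    have hc := (H.cont (ρ, x) ⟨Or.inr hρ, hx⟩).eventually hm
    rw [eventually_nhdsWithin_iff] at hc
    have hI : ∀ᶠ z : ℝ × P in 𝓝 (ρ, x), z.1 ∈ radii κ :=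
      continuous_fst.continuousAt.eventually ((isOpen_radii κ).mem_nhds hρ)
    filter_upwards [hc, hI] with z hz hz' hz'' using hz ⟨Or.inr hz', hz''⟩
  obtain ⟨δ, hδ, hB⟩ := Metric.eventually_nhds_iff.1 h2
  have h3 : ∀ᶠ ε in 𝓝[>] (0 : ℝ), ε < δ := nhdsWithin_le_nhds (gt_mem_nhds hδ)
  filter_upwards [h3] with ε hε q hq
  obtain ⟨x, hx, h⟩ := H.exists_eq q
  rw [← h]
  refine hB ?_ x hx hx
  rw [Real.dist_eq, abs_lt]
  constructor <;> linarith [hq.1, hq.2]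

/-- The shell has volume `ω ∫_ρ^{ρ+ε} 𝔰_κⁿ`, so the quotient by `ε` has a genuine limit, given by
the fundamental theorem of calculus. -/
theorem minkowskiContent_eq {ρ : ℝ} (hρ : ρ ∈ radii κ) :
    L.minkowskiContent {q | rad q = ρ} = ω * ENNReal.ofReal (sn κ ρ ^ n) := by
  have hlim : Tendsto (fun ε : ℝ => L.vol {q | rad q ∈ Ioo ρ (ρ + ε)} / ENNReal.ofReal ε)
      (𝓝[>] 0) (𝓝 (ω * ENNReal.ofReal (sn κ ρ ^ n))) := by
    have h1 : HasDerivAt (fun u => ∫ s in ρ..u, sn κ s ^ n) (sn κ ρ ^ n) ρ :=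
      intervalIntegral.integral_hasDerivAt_right (by simp)
        (((continuous_sn κ).pow n).stronglyMeasurableAtFilter _ _)
        ((continuous_sn κ).pow n).continuousAt
    have h2 := h1.tendsto_slope_zero_right
    have h3 := ENNReal.Tendsto.const_mul (ENNReal.tendsto_ofReal h2)
      (Or.inr H.ω_ne_top : ENNReal.ofReal (sn κ ρ ^ n) ≠ 0 ∨ ω ≠ ⊤)
    refine h3.congr' ?_
    filter_upwards [eventually_Icc_subset_radii hρ, self_mem_nhdsWithin] with ε hε hpos
    have hpos : 0 < ε := hpos
    rw [H.vol _ (Ioo_subset_Icc_self.trans hε) measurableSet_Ioo,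
      setLIntegral_congr (Ioo_ae_eq_Ioc (μ := volume)),
      lintegral_sn_pow hρ.1.le (by linarith) (hε ⟨by linarith, le_rfl⟩),
      mul_div_assoc, ← ENNReal.ofReal_div_of_pos hpos]
    simp [div_eq_inv_mul]
  unfold Space.minkowskiContent
  simp only [H.preimage_tauFrom_level (Or.inr hρ)]
  apply le_antisymm
  · refine (iInf₂_le univ ⟨isOpen_univ, subset_univ _⟩).trans ?_
    simp only [inter_univ]
    exact hlim.limsup_eq.le
  · refine le_iInf₂ fun U hU => ?_
    rw [← hlim.limsup_eq]
    refine (limsup_congr ?_).le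
    filter_upwards [H.eventually_subset_of_isOpen hρ hU.1 hU.2] with ε hε
    rw [inter_eq_left.2 hε]

/-- A geodesic from `V` to `S` has positive `τ(γ 0, γ 1)`, so `γ t ≪ γ 1` for `t < 1` and the radius
stays at most `ρ`. Conversely, a point of radius at most `ρ` lies on the radial geodesic `t ↦ E (tρ)
x`, at parameter `rad q / ρ`; all partition sums of that curve telescope to `ρ`. -/
theorem cone_eq {ρ : ℝ} (hρ : ρ ∈ radii κ) :
    L.cone {q | rad q = 0} {q | rad q = ρ} = {q | rad q ≤ ρ} := by
  have hI : ∀ t : unitInterval, (t : ℝ) * ρ ∈ insert 0 (radii κ) := fun t =>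
    mem_insert_radii_of_le hρ (mul_nonneg t.2.1 hρ.1.le)
      (mul_le_of_le_one_left hρ.1.le t.2.2)
  apply Subset.antisymm
  · rintro _ ⟨γ, hγ, t, h0, h1, -, rfl⟩
    have h0 : rad (γ 0) = 0 := h0
    have h1 : rad (γ 1) = ρ := h1
    rcases t.2.2.eq_or_lt with ht | ht
    · rw [show t = 1 from Subtype.ext ht]; exact h1.le
    have h2 := hγ t 1 ht
    have h3 : 0 < L.τ (γ 0) (γ 1) := by
      obtain ⟨x, hx, hq⟩ := H.exists_eq (γ 1)
      rw [h1] at hq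
      have : γ 0 = E 0 x := H.level_zero_subsingleton h0 (H.rad_E 0 (Or.inl rfl) x hx)
      rw [this, ← hq, H.τ_eq (Or.inl rfl) (Or.inr hρ) hρ.1.le hx]
      simpa using hρ.1
    have h4 : L.chron (γ t) (γ 1) := by
      unfold Space.chron
      rw [h2]
      refine ENNReal.mul_pos ?_ h3.ne'
      simpa using ht
    rw [← h1]
    exact (H.rad_lt_of_chron h4).le
  · intro q hq
    have hq : rad q ≤ ρ := hq
    obtain ⟨x, hx, hqx⟩ := H.exists_eq q
    have hcont : Continuous fun t : unitInterval => E (t * ρ) x := by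
      refine H.cont.comp_continuous (f := fun t : unitInterval => ((t : ℝ) * ρ, x))
        (by fun_prop) fun t => ⟨hI t, hx⟩
    let γ : C(unitInterval, X) := ⟨_, hcont⟩
    have hγ : ∀ t, γ t = E (t * ρ) x := fun _ => rfl
    have hτ : ∀ s t : unitInterval, s ≤ t →
        L.τ (γ s) (γ t) = ENNReal.ofReal (((t : ℝ) - s) * ρ) := by
      intro s t hst
      rw [hγ, hγ, H.τ_eq (hI s) (hI t) (mul_le_mul_of_nonneg_right hst hρ.1.le) hx, sub_mul]
    have hrad : ∀ t, rad (γ t) = t * ρ := fun t => H.rad_E _ (hI t) x hx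
    have hsum : ∀ (k : ℕ) (t : Fin (k + 1) → unitInterval),
        StrictMono t ∧ t 0 = 0 ∧ t (Fin.last k) = 1 →
        ∑ i : Fin k, L.τ (γ (t i.castSucc)) (γ (t i.succ)) = ENNReal.ofReal ρ := by
      rintro k t ⟨hm, h0, h1⟩
      have hle : ∀ i : Fin k, t i.castSucc ≤ t i.succ := fun i =>
        hm.monotone (Fin.castSucc_lt_succ).le
      rw [Finset.sum_congr rfl fun i _ => hτ _ _ (hle i), ← ENNReal.ofReal_sum_of_nonneg]
      · congr 1
        rw [← Finset.sum_mul]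
        rw [sum_succ_sub_castSucc fun i => (t i : ℝ), h0, h1]
        simp
      · intro i _
        exact mul_nonneg (sub_nonneg.2 (hle i)) hρ.1.le
    have hlen : L.length γ = ENNReal.ofReal ρ := by
      apply le_antisymm
      · have h : StrictMono (![0, 1] : Fin 2 → unitInterval) ∧
            (![0, 1] : Fin 2 → unitInterval) 0 = 0 ∧
            (![0, 1] : Fin 2 → unitInterval) (Fin.last 1) = 1 := by
          refine ⟨?_, rfl, rfl⟩
          rw [Fin.strictMono_iff_lt_succ]
          intro i
          fin_cases i
          exact zero_lt_one
        rw [← hsum 1 _ h]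
        exact iInf_le_of_le 1 <| iInf_le_of_le _ <| iInf_le_of_le h le_rfl
      · exact le_iInf fun k => le_iInf fun t => le_iInf fun h => (hsum k t h).ge
    have h1 : rad (γ 1) = ρ := by rw [hrad]; simp
    have h01 : L.τ (γ 0) (γ 1) = ENNReal.ofReal ρ := by
      rw [hτ 0 1 zero_le_one]; simp
    refine ⟨γ, fun s t hst => ?_, ⟨rad q / ρ, ?_, ?_⟩, ?_, h1, ?_, ?_⟩
    · rw [h01, hτ s t hst.le, ENNReal.ofReal_mul (sub_nonneg.2 hst.le)]
    · exact div_nonneg (nonneg_of_mem_insert_radii (H.rad_mem q)) hρ.1.le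
    · exact div_le_one_of_le₀ hq hρ.1.le
    · change rad (γ 0) = 0
      rw [hrad]; simp
    · rw [hlen, H.tauFrom_level (Or.inl rfl) (by rw [h1]; exact hρ.1), h1, sub_zero,
        EReal.coe_ennreal_ofReal, max_eq_left hρ.1.le]
    · rw [hγ]
      simp only [div_mul_cancel₀ _ hρ.1.ne']
      exact hqx.symm

theorem vol_cone {ρ : ℝ} (hρ : ρ ∈ radii κ) :
    L.vol (L.cone {q | rad q = 0} {q | rad q = ρ}) =
      ω * ENNReal.ofReal (∫ s in (0 : ℝ)..ρ, sn κ s ^ n) := by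
  have h1 : {q | rad q ≤ ρ} = {q | rad q = 0} ∪ {q | rad q ∈ Ioc 0 ρ} := by
    ext q
    have := nonneg_of_mem_insert_radii (H.rad_mem q)
    simp only [mem_ofPred_eq, mem_union, mem_Ioc]
    constructor
    · intro h
      rcases this.eq_or_lt with h0 | h0
      · exact Or.inl h0.symm
      · exact Or.inr ⟨h0, h⟩
    · rintro (h | h)
      · rw [h]; exact hρ.1.le
      · exact h.2
  have h2 : L.vol ({q | rad q = 0} ∪ {q | rad q ∈ Ioc 0 ρ}) = L.vol {q | rad q ∈ Ioc 0 ρ} :=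
    le_antisymm ((measure_union_le _ _).trans (by rw [H.vol_tip, zero_add]))
      (measure_mono subset_union_right)
  rw [H.cone_eq hρ, h1, h2, H.vol _ (fun r hr => mem_radii_of_le hρ hr.1 hr.2) measurableSet_Ioc,
    lintegral_sn_pow le_rfl hρ.1.le hρ]

theorem attainsEquality [T1Space X] [MeasurableSingletonClass X] {K : ℝ} {N : ℕ} {ρ : ℝ}
    {A : ENNReal} (hκ : κ = K / ((N : ℝ) - 1)) (hn : n = N - 1) (hρ : ρ ∈ radii κ)
    (hA : A = ω * ENNReal.ofReal (sn κ ρ ^ n)) :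
    AttainsEquality L K N {q | rad q = 0} {q | rad q = ρ} ρ A := by
  have hs := sn_pos hρ
  have hint : 0 < ∫ s in (0 : ℝ)..ρ, sn κ s ^ n :=
    intervalIntegral.intervalIntegral_pos_of_pos_on (((continuous_sn κ).pow n).intervalIntegrable _ _)
      (fun r hr => pow_pos (sn_pos (mem_radii_of_le hρ hr.1 hr.2.le)) n) hρ.1
  refine ⟨H.admissible hρ, H.dist_eq hρ, (H.minkowskiContent_eq hρ).trans hA.symm, ?_, ?_, ?_⟩
  · rw [H.vol_cone hρ]
    exact ENNReal.mul_pos H.ω_ne_zero (by simpa using hint)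
  · rw [H.vol_cone hρ]
    exact ENNReal.mul_lt_top H.ω_ne_top.lt_top ENNReal.ofReal_lt_top
  · rw [H.vol_cone hρ, H.dist_eq hρ, EReal.toReal_coe, H.minkowskiContent_eq hρ, mul_assoc,
      ← ENNReal.ofReal_mul (by positivity)]
    unfold DKN
    rw [← hκ, ← hn, ← mul_assoc, mul_one_div_cancel (by positivity), one_mul]

end PolarModel

end

section

/-! ### Derivatives of the comparison functions -/

theorem hasDerivAt_sn (κ r : ℝ) : HasDerivAt (sn κ) (cs κ r) r := by
  have hlin : ∀ k : ℝ, HasDerivAt (fun r : ℝ => k * r) k r := fun k => by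
    simpa using (hasDerivAt_id r).const_mul k
  rcases lt_trichotomy κ 0 with h | h | h
  · have hk : Real.sqrt (-κ) ≠ 0 := (Real.sqrt_pos.2 (by linarith)).ne'
    have := ((hlin (Real.sqrt (-κ))).sinh).div_const (Real.sqrt (-κ))
    rw [mul_div_cancel_right₀ _ hk] at this
    have e : sn κ = fun r => Real.sinh (Real.sqrt (-κ) * r) / Real.sqrt (-κ) := by
      ext; simp [sn, h, h.not_gt]
    rw [e]
    simpa [cs, h, h.not_gt] using this
  · subst h
    have e : sn 0 = id := by ext; simp [sn]
    rw [e]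
    simpa [cs] using hasDerivAt_id r
  · have hk : Real.sqrt κ ≠ 0 := (Real.sqrt_pos.2 h).ne'
    have := ((hlin (Real.sqrt κ)).sin).div_const (Real.sqrt κ)
    rw [mul_div_cancel_right₀ _ hk] at this
    have e : sn κ = fun r => Real.sin (Real.sqrt κ * r) / Real.sqrt κ := by
      ext; simp [sn, h]
    rw [e]
    simpa [cs, h] using this

theorem hasDerivAt_cs (κ r : ℝ) : HasDerivAt (cs κ) (-κ * sn κ r) r := by
  have hlin : ∀ k : ℝ, HasDerivAt (fun r : ℝ => k * r) k r := fun k => by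
    simpa using (hasDerivAt_id r).const_mul k
  rcases lt_trichotomy κ 0 with h | h | h
  · have h2 := Real.mul_self_sqrt (show 0 ≤ -κ by linarith)
    have hk : Real.sqrt (-κ) ≠ 0 := (Real.sqrt_pos.2 (by linarith)).ne'
    have := (hlin (Real.sqrt (-κ))).cosh
    convert this using 1
    · ext; simp [cs, h, h.not_gt]
    · simp only [sn, h, h.not_gt, if_true, if_false]
      field_simp
      linear_combination -Real.sinh (√(-κ) * r) * h2
  · subst h
    have e : cs 0 = fun _ => 1 := by ext; simp [cs]
    rw [e]
    simpa using hasDerivAt_const r (1 : ℝ)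
  · have h2 := Real.mul_self_sqrt h.le
    have hk : Real.sqrt κ ≠ 0 := (Real.sqrt_pos.2 h).ne'
    have := (hlin (Real.sqrt κ)).cos
    convert this using 1
    · ext; simp [cs, h]
    · simp only [sn, h, if_true]
      field_simp
      linear_combination Real.sin (√κ * r) * h2

theorem cs_zero (κ : ℝ) : cs κ 0 = 1 := by
  unfold cs
  split_ifs <;> simp

theorem cs_sq_add (κ r : ℝ) : cs κ r ^ 2 + κ * sn κ r ^ 2 = 1 := by
  rcases lt_trichotomy κ 0 with h | h | h
  · have h2 := Real.sq_sqrt (show 0 ≤ -κ by linarith)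
    simp only [sn, cs, h, h.not_gt, if_true, if_false, div_pow, h2]
    rw [div_neg, mul_neg, mul_div_cancel₀ _ h.ne, Real.cosh_sq]
    ring
  · subst h
    simp [cs]
  · have h2 := Real.sq_sqrt h.le
    simp only [sn, cs, h, if_true, div_pow, h2]
    rw [mul_div_cancel₀ _ h.ne', Real.cos_sq_add_sin_sq]

theorem sn_zero_left (r : ℝ) : sn 0 r = r := by simp [sn]

/-! ### The unit hyperboloid -/

variable {n : ℕ}

theorem hasFDerivAt_hyp (x : Euc n) : HasFDerivAt (hyp n)
    ((ContinuousLinearMap.id ℝ (Euc n)).prod ((Real.sqrt (1 + ‖x‖ ^ 2))⁻¹ • innerSL ℝ x)) x := by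
  have h1 : HasFDerivAt (fun x : Euc n => 1 + ‖x‖ ^ 2) (2 • innerSL ℝ x) x :=
    (hasStrictFDerivAt_norm_sq x).hasFDerivAt.const_add 1
  have h2 := (hasFDerivAt_id x).prodMk (h1.sqrt (by positivity))
  refine h2.congr_fderiv ?_
  congr 1
  ext v
  simp
  field_simp

theorem hyp_form_self (x : Euc n) : (hyp n x).2 ^ 2 - ‖(hyp n x).1‖ ^ 2 = 1 := by
  simp only [hyp]
  rw [Real.sq_sqrt (by positivity)]
  ring

theorem hyp_snd_pos (x : Euc n) : 0 < (hyp n x).2 := Real.sqrt_pos.2 (by positivity)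

theorem continuous_hyp : Continuous (hyp n) := by
  unfold hyp
  fun_prop

theorem hypCap_eq_image (a : ℝ) : hypCap n a = hyp n '' Metric.closedBall 0 a := by
  ext u
  constructor
  · rintro ⟨h1, h2, h3⟩
    refine ⟨u.1, by simpa using h3, Prod.ext rfl ?_⟩
    simp only [hyp]
    rw [show 1 + ‖u.1‖ ^ 2 = u.2 ^ 2 by linarith, Real.sqrt_sq h2.le]
  · rintro ⟨x, hx, rfl⟩
    exact ⟨hyp_form_self x, hyp_snd_pos x, mem_closedBall_zero_iff.1 hx⟩

/-- The position vector is normal to the hyperboloid; this removes the mixed terms of the metric in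
polar coordinates. -/
theorem minkForm_hyp_fderiv (x v : Euc n) : minkForm n (hyp n x) (fderiv ℝ (hyp n) x v) = 0 := by
  rw [(hasFDerivAt_hyp x).fderiv]
  have : Real.sqrt (1 + ‖x‖ ^ 2) ≠ 0 := (Real.sqrt_pos.2 (by positivity)).ne'
  simp [minkForm, hyp, this]

/-- The Gram matrix is the rank-one perturbation `1 - x xᵀ / (1 + ‖x‖²)` of the identity, with
determinant `1 / (1 + ‖x‖²)` by the matrix determinant lemma. -/
theorem gramDensity_hyp (x : Euc n) :
    gramDensity (minkForm n) (eucBasis n) (hyp n) x = (Real.sqrt (1 + ‖x‖ ^ 2))⁻¹ := by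
  have hpos : 0 < 1 + ‖x‖ ^ 2 := by positivity
  have hM : (Matrix.of fun i j => minkForm n (fderiv ℝ (hyp n) x (eucBasis n i))
      (fderiv ℝ (hyp n) x (eucBasis n j))) =
      1 + Matrix.replicateCol Unit (fun i => -(1 + ‖x‖ ^ 2)⁻¹ * x i) *
        Matrix.replicateRow Unit (fun i => x i) := by
    ext i j
    rw [(hasFDerivAt_hyp x).fderiv]
    have hs : Real.sqrt (1 + ‖x‖ ^ 2) * Real.sqrt (1 + ‖x‖ ^ 2) = 1 + ‖x‖ ^ 2 :=
      Real.mul_self_sqrt hpos.le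
    simp only [minkForm, eucBasis, Matrix.of_apply, ContinuousLinearMap.prod_apply,
      ContinuousLinearMap.id_apply, _root_.smul_apply, innerSL_apply_apply,
      EuclideanSpace.inner_single_right, Matrix.add_apply, Matrix.mul_apply, smul_eq_mul,
      Matrix.replicateCol_apply, Matrix.replicateRow_apply, Finset.univ_unique, Finset.sum_const,
      Finset.card_singleton, one_smul, conj_trivial, one_mul, Matrix.one_apply]
    have h1 : (EuclideanSpace.single i (1 : ℝ) : Euc n) j = if i = j then 1 else 0 := by
      simp [eq_comm]
    rw [h1, show ∀ b c d : ℝ, b⁻¹ * c * (b⁻¹ * d) = (b * b)⁻¹ * c * d from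
      fun b c d => by rw [mul_inv]; ring, hs]
    ring
  unfold gramDensity
  rw [hM, Matrix.det_one_add_replicateCol_mul_replicateRow]
  have h2 : (∑ i, x i * x i) = ‖x‖ ^ 2 := by
    rw [EuclideanSpace.norm_sq_eq]
    exact Finset.sum_congr rfl fun i _ => by rw [Real.norm_eq_abs, sq_abs, sq]
  have h3 : dotProduct (fun i => x i) (fun i => -(1 + ‖x‖ ^ 2)⁻¹ * x i) =
      -(1 + ‖x‖ ^ 2)⁻¹ * ‖x‖ ^ 2 := by
    rw [← h2, Finset.mul_sum]
    exact Finset.sum_congr rfl fun i _ => by ring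
  rw [h3, show 1 + -(1 + ‖x‖ ^ 2)⁻¹ * ‖x‖ ^ 2 = (1 + ‖x‖ ^ 2)⁻¹ by field_simp; ring,
    abs_of_pos (by positivity), Real.sqrt_inv]

/-- The hyperbolic volume of `hypCap n a`. -/
def capVolume (n : ℕ) (a : ℝ) : ENNReal :=
  ∫⁻ x in Metric.closedBall (0 : Euc n) a, ENNReal.ofReal (Real.sqrt (1 + ‖x‖ ^ 2))⁻¹

theorem continuous_capDensity :
    Continuous fun x : Euc n => (Real.sqrt (1 + ‖x‖ ^ 2))⁻¹ :=
  Continuous.inv₀ (by fun_prop) fun x => (Real.sqrt_pos.2 (by positivity)).ne'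

theorem capVolume_ne_top (a : ℝ) : capVolume n a ≠ ⊤ := by
  refine ne_top_of_le_ne_top
    (measure_closedBall_lt_top (μ := volume) (x := (0 : Euc n)) (r := a)).ne ?_
  unfold capVolume
  rw [← setLIntegral_one]
  refine lintegral_mono fun x => ?_
  rw [← ENNReal.ofReal_one]
  refine ENNReal.ofReal_le_ofReal (inv_le_one_of_one_le₀ ?_)
  rw [Real.one_le_sqrt]
  nlinarith [norm_nonneg x]

theorem capVolume_ne_zero {a : ℝ} (ha : 0 < a) : capVolume n a ≠ 0 := by
  unfold capVolume
  rw [Ne, lintegral_eq_zero_iff (continuous_capDensity.measurable.ennreal_ofReal)]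
  intro h
  have h2 : ∀ᵐ x ∂(volume.restrict (Metric.closedBall (0 : Euc n) a)), False := by
    filter_upwards [h] with x hx
    have : 0 < (Real.sqrt (1 + ‖x‖ ^ 2))⁻¹ := inv_pos.2 (Real.sqrt_pos.2 (by positivity))
    simp only [Pi.zero_apply, ENNReal.ofReal_eq_zero] at hx
    linarith
  rw [Filter.eventually_false_iff_eq_bot, ae_eq_bot, Measure.restrict_eq_zero] at h2
  exact (Metric.measure_closedBall_pos volume (0 : Euc n) ha).ne' h2

/-! ### Parametrized volumes -/

theorem paramVolume_apply {W ι P : Type*} [NormedAddCommGroup W] [NormedSpace ℝ W] [Fintype ι]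
    [DecidableEq ι] [NormedAddCommGroup P] [NormedSpace ℝ P] [MeasureSpace P] [MeasurableSpace W]
    {B : W → W → ℝ} {b : ι → P} {Φ : P → W} {D : Set P} (hΦ : Measurable Φ) {A : Set W}
    (hA : MeasurableSet A) :
    paramVolume B b Φ D A =
      ∫⁻ z in Φ ⁻¹' A ∩ D, ENNReal.ofReal (gramDensity B b Φ z) := by
  unfold paramVolume
  rw [Measure.map_apply hΦ hA, withDensity_apply _ (hΦ hA), Measure.restrict_restrict (hΦ hA)]

theorem gramDensity_eq_of_conformal {W : Type*} [NormedAddCommGroup W] [NormedSpace ℝ W]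
    {B : W → W → ℝ} {Φ : Euc n → W} {x : Euc n} {c : ℝ} (hc : 0 ≤ c)
    (h : ∀ u v, B (fderiv ℝ Φ x u) (fderiv ℝ Φ x v) =
      c ^ 2 * minkForm n (fderiv ℝ (hyp n) x u) (fderiv ℝ (hyp n) x v)) :
    gramDensity B (eucBasis n) Φ x = c ^ n * (Real.sqrt (1 + ‖x‖ ^ 2))⁻¹ := by
  rw [← gramDensity_hyp]
  unfold gramDensity
  simp only [h]
  rw [show (Matrix.of fun i j => c ^ 2 * minkForm n (fderiv ℝ (hyp n) x (eucBasis n i))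
      (fderiv ℝ (hyp n) x (eucBasis n j))) = c ^ 2 • (Matrix.of fun i j =>
      minkForm n (fderiv ℝ (hyp n) x (eucBasis n i)) (fderiv ℝ (hyp n) x (eucBasis n j))) from rfl,
    Matrix.det_smul, abs_mul, Fintype.card_fin, abs_of_nonneg (by positivity),
    Real.sqrt_mul (by positivity), ← pow_mul, mul_comm 2 n, pow_mul, Real.sqrt_sq (by positivity)]

theorem lintegral_conformal (a c : ℝ) (hc : 0 ≤ c) :
    ∫⁻ x in Metric.closedBall (0 : Euc n) a,
      ENNReal.ofReal (c ^ n * (Real.sqrt (1 + ‖x‖ ^ 2))⁻¹) =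
    capVolume n a * ENNReal.ofReal (c ^ n) := by
  simp only [ENNReal.ofReal_mul (pow_nonneg hc n)]
  rw [lintegral_const_mul _ continuous_capDensity.measurable.ennreal_ofReal, mul_comm]
  rfl

theorem paramVolume_image_of_conformal {W : Type*} [NormedAddCommGroup W] [NormedSpace ℝ W]
    [MeasurableSpace W] [BorelSpace W] {B : W → W → ℝ} {Φ : Euc n → W} {c : ℝ} (a : ℝ)
    (hc : 0 ≤ c) (hΦ : Continuous Φ)
    (h : ∀ x u v, B (fderiv ℝ Φ x u) (fderiv ℝ Φ x v) =
      c ^ 2 * minkForm n (fderiv ℝ (hyp n) x u) (fderiv ℝ (hyp n) x v)) :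
    paramVolume B (eucBasis n) Φ (Metric.closedBall 0 a) (Φ '' Metric.closedBall 0 a) =
      capVolume n a * ENNReal.ofReal (c ^ n) := by
  rw [paramVolume_apply hΦ.measurable
    ((isCompact_closedBall _ _).image hΦ).isClosed.measurableSet,
    inter_eq_right.2 (subset_preimage_image _ _), ← lintegral_conformal a _ hc]
  exact lintegral_congr fun x => by rw [gramDensity_eq_of_conformal hc (h x)]

/-! ### Quadrics -/

/-- `x · x' - t t' + σ w w'`. -/
def ambForm (n : ℕ) (σ : ℝ) (u v : Amb n) : ℝ :=
  minkForm n (u.1, u.2.1) (v.1, v.2.1) + σ * (u.2.2 * v.2.2)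

theorem dSForm_eq : dSForm n = ambForm n 1 := by
  funext u v
  simp only [dSForm, ambForm, minkForm]
  ring

theorem adSForm_eq : adSForm n = ambForm n (-1) := by
  funext u v
  simp only [adSForm, ambForm, minkForm]
  ring

theorem hasFDerivAt_expPt (κ r : ℝ) (x : Euc n) :
    HasFDerivAt (fun z : ℝ × Euc n => expPt n κ z.1 (hyp n z.2))
      (((sn κ r • ContinuousLinearMap.snd ℝ ℝ (Euc n)) +
          (cs κ r • ContinuousLinearMap.fst ℝ ℝ (Euc n)).smulRight x).prod
        (((sn κ r • (((Real.sqrt (1 + ‖x‖ ^ 2))⁻¹ • innerSL ℝ x).comp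
            (ContinuousLinearMap.snd ℝ ℝ (Euc n)))) +
          (cs κ r * Real.sqrt (1 + ‖x‖ ^ 2)) • ContinuousLinearMap.fst ℝ ℝ (Euc n)).prod
        ((-κ * sn κ r / Real.sqrt |κ|) • ContinuousLinearMap.fst ℝ ℝ (Euc n)))) (r, x) := by
  have h0 : HasFDerivAt (fun z : ℝ × Euc n => z.1) (ContinuousLinearMap.fst ℝ ℝ (Euc n)) (r, x) :=
    hasFDerivAt_fst
  have h1 : HasFDerivAt (fun z : ℝ × Euc n => sn κ z.1)
      (cs κ r • ContinuousLinearMap.fst ℝ ℝ (Euc n)) (r, x) :=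
    (hasDerivAt_sn κ r).comp_hasFDerivAt_of_eq (r, x) h0 rfl
  have h2 : HasFDerivAt (fun z : ℝ × Euc n => cs κ z.1 / Real.sqrt |κ|)
      ((-κ * sn κ r / Real.sqrt |κ|) • ContinuousLinearMap.fst ℝ ℝ (Euc n)) (r, x) :=
    ((hasDerivAt_cs κ r).div_const (Real.sqrt |κ|)).comp_hasFDerivAt_of_eq (r, x) h0 rfl
  have h3 : HasFDerivAt (fun z : ℝ × Euc n => z.2) (ContinuousLinearMap.snd ℝ ℝ (Euc n)) (r, x) :=
    hasFDerivAt_snd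
  have h4 : HasFDerivAt (fun x : Euc n => Real.sqrt (1 + ‖x‖ ^ 2))
      ((Real.sqrt (1 + ‖x‖ ^ 2))⁻¹ • innerSL ℝ x) x := (hasFDerivAt_hyp x).snd
  have h5 : HasFDerivAt (fun z : ℝ × Euc n => Real.sqrt (1 + ‖z.2‖ ^ 2))
      (((Real.sqrt (1 + ‖x‖ ^ 2))⁻¹ • innerSL ℝ x).comp (ContinuousLinearMap.snd ℝ ℝ (Euc n)))
      (r, x) :=
    HasFDerivAt.comp (g := fun x : Euc n => Real.sqrt (1 + ‖x‖ ^ 2)) (r, x) h4 h3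
  have h6 : HasFDerivAt (fun z : ℝ × Euc n => sn κ z.1 * Real.sqrt (1 + ‖z.2‖ ^ 2))
      ((sn κ r • (((Real.sqrt (1 + ‖x‖ ^ 2))⁻¹ • innerSL ℝ x).comp
            (ContinuousLinearMap.snd ℝ ℝ (Euc n)))) +
          (cs κ r * Real.sqrt (1 + ‖x‖ ^ 2)) • ContinuousLinearMap.fst ℝ ℝ (Euc n)) (r, x) := by
    refine (h1.mul h5).congr_fderiv ?_
    rw [smul_smul, mul_comm (Real.sqrt _)]
  exact (h1.smul h3).prodMk (h6.prodMk h2)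

theorem fderiv_expPt_apply (κ r : ℝ) (x : Euc n) (z : ℝ × Euc n) :
    fderiv ℝ (fun z : ℝ × Euc n => expPt n κ z.1 (hyp n z.2)) (r, x) z =
      (sn κ r • (fderiv ℝ (hyp n) x z.2).1 + (cs κ r * z.1) • (hyp n x).1,
        sn κ r * (fderiv ℝ (hyp n) x z.2).2 + cs κ r * z.1 * (hyp n x).2,
        -κ * sn κ r / Real.sqrt |κ| * z.1) := by
  rw [(hasFDerivAt_expPt κ r x).fderiv, (hasFDerivAt_hyp x).fderiv]
  simp [hyp]
  ring

/-- The metric `-dr² + 𝔰_κ² g_ℍ`. The coefficient of `dr²` is `-(𝔠_κ² + κ 𝔰_κ²) = -1`, where `σ |κ|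
= -κ` gives the second term the same sign rule for both quadrics. -/
theorem ambForm_fderiv_expPt {κ σ : ℝ} (hσ : σ * |κ| = -κ) (hκ : κ ≠ 0) (r : ℝ) (x : Euc n)
    (z z' : ℝ × Euc n) :
    ambForm n σ (fderiv ℝ (fun z : ℝ × Euc n => expPt n κ z.1 (hyp n z.2)) (r, x) z)
      (fderiv ℝ (fun z : ℝ × Euc n => expPt n κ z.1 (hyp n z.2)) (r, x) z') =
    sn κ r ^ 2 * minkForm n (fderiv ℝ (hyp n) x z.2) (fderiv ℝ (hyp n) x z'.2) - z.1 * z'.1 := by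
  have h0 : 0 < |κ| := abs_pos.2 hκ
  have h1 := minkForm_hyp_fderiv x z.2
  have h2 := minkForm_hyp_fderiv x z'.2
  have h3 := hyp_form_self x
  have h4 : ∀ b c : ℝ, σ * (-κ * sn κ r / Real.sqrt |κ| * b * (-κ * sn κ r / Real.sqrt |κ| * c)) =
      -κ * sn κ r ^ 2 * (b * c) := by
    intro b c
    have h5 : Real.sqrt |κ| * Real.sqrt |κ| = |κ| := Real.mul_self_sqrt h0.le
    have h6 : κ ^ 2 = |κ| ^ 2 := (sq_abs κ).symm
    have h7 : Real.sqrt |κ| ≠ 0 := (Real.sqrt_pos.2 h0).ne'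
    calc _ = σ * (κ ^ 2 * sn κ r ^ 2 * (b * c) / (Real.sqrt |κ| * Real.sqrt |κ|)) := by
          field_simp
      _ = σ * |κ| * sn κ r ^ 2 * (b * c) := by rw [h5, h6]; field_simp
      _ = _ := by rw [hσ]
  have h8 := cs_sq_add κ r
  rw [fderiv_expPt_apply, fderiv_expPt_apply]
  unfold ambForm
  rw [h4]
  simp only [minkForm] at h1 h2 ⊢
  simp only [inner_add_left, inner_add_right, real_inner_smul_left, real_inner_smul_right]
  rw [real_inner_comm] at h1
  rw [real_inner_self_eq_norm_sq]
  linear_combination (-(z.1 * z'.1)) * h8 - (cs κ r ^ 2 * z.1 * z'.1) * h3 +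
    sn κ r * cs κ r * z'.1 * h1 + sn κ r * cs κ r * z.1 * h2

/-- The Gram matrix is block diagonal: `-1` in the radial direction and `𝔰_κ²` times that of the
hyperboloid. -/
theorem gramDensity_polar {κ σ : ℝ} (hσ : σ * |κ| = -κ) (hκ : κ ≠ 0) {r : ℝ} (hr : r ∈ radii κ)
    (x : Euc n) :
    gramDensity (ambForm n σ) (polarBasis n) (fun z => expPt n κ z.1 (hyp n z.2)) (r, x) =
      sn κ r ^ n * (Real.sqrt (1 + ‖x‖ ^ 2))⁻¹ := by
  have hs := (sn_pos hr).le
  rw [← gramDensity_hyp]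
  unfold gramDensity
  simp only [ambForm_fderiv_expPt hσ hκ]
  set M := (Matrix.of fun i j => minkForm n (fderiv ℝ (hyp n) x (eucBasis n i))
      (fderiv ℝ (hyp n) x (eucBasis n j)))
  have hM : (Matrix.of fun i j => sn κ r ^ 2 * minkForm n
      (fderiv ℝ (hyp n) x (polarBasis n i).2) (fderiv ℝ (hyp n) x (polarBasis n j).2) -
      (polarBasis n i).1 * (polarBasis n j).1) =
      Matrix.fromBlocks (-1 : Matrix Unit Unit ℝ) 0 0 (sn κ r ^ 2 • M) := by
    ext (i | i) (j | j) <;> simp [polarBasis, M, minkForm]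
  rw [hM, Matrix.det_fromBlocks_zero₂₁, Matrix.det_smul, Fintype.card_fin]
  rw [abs_mul, abs_mul, show |(-1 : Matrix Unit Unit ℝ).det| = 1 by simp, one_mul,
    abs_of_nonneg (by positivity),
    Real.sqrt_mul (by positivity), ← pow_mul, mul_comm 2 n, pow_mul, Real.sqrt_sq (by positivity)]

theorem continuous_expPt_hyp (κ : ℝ) :
    Continuous fun z : ℝ × Euc n => expPt n κ z.1 (hyp n z.2) :=
  continuous_iff_continuousAt.2 fun z => (hasFDerivAt_expPt κ z.1 z.2).continuousAt

theorem quadricVolume_apply {κ σ a : ℝ} (hσ : σ * |κ| = -κ) (hκ : κ ≠ 0) {A : Set (Amb n)}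
    (hA : MeasurableSet A) {J : Set ℝ} (hJ : J ⊆ radii κ) (hJm : MeasurableSet J)
    (h : (fun z : ℝ × Euc n => expPt n κ z.1 (hyp n z.2)) ⁻¹' A ∩ radii κ ×ˢ univ =
      J ×ˢ Metric.closedBall 0 a) :
    quadricVolume n (ambForm n σ) κ A =
      capVolume n a * ∫⁻ r in J, ENNReal.ofReal (sn κ r ^ n) := by
  unfold quadricVolume
  rw [paramVolume_apply (continuous_expPt_hyp κ).measurable hA, h]
  have h1 : ∀ z ∈ J ×ˢ Metric.closedBall (0 : Euc n) a,
      ENNReal.ofReal (gramDensity (ambForm n σ) (polarBasis n)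
        (fun z => expPt n κ z.1 (hyp n z.2)) z) =
      ENNReal.ofReal (sn κ z.1 ^ n) * ENNReal.ofReal (Real.sqrt (1 + ‖z.2‖ ^ 2))⁻¹ := by
    rintro ⟨r, x⟩ ⟨hr, -⟩
    rw [gramDensity_polar hσ hκ (hJ hr), ENNReal.ofReal_mul (pow_nonneg (sn_pos (hJ hr)).le n)]
  rw [setLIntegral_congr_fun (hJm.prod Metric.isClosed_closedBall.measurableSet) h1,
    Measure.volume_eq_prod, ← Measure.prod_restrict,
    lintegral_prod_mul (f := fun r => ENNReal.ofReal (sn κ r ^ n))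
      (g := fun x : Euc n => ENNReal.ofReal (Real.sqrt (1 + ‖x‖ ^ 2))⁻¹), mul_comm]
  · rfl
  · exact ((continuous_sn κ).pow n).measurable.ennreal_ofReal.aemeasurable
  · exact continuous_capDensity.measurable.ennreal_ofReal.aemeasurable

theorem paramVolume_slice {κ σ a ρ : ℝ} (hσ : σ * |κ| = -κ) (hκ : κ ≠ 0) (hρ : ρ ∈ radii κ) :
    paramVolume (ambForm n σ) (eucBasis n) (fun x => expPt n κ ρ (hyp n x))
      (Metric.closedBall 0 a) ((fun x => expPt n κ ρ (hyp n x)) '' Metric.closedBall 0 a) =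
    capVolume n a * ENNReal.ofReal (sn κ ρ ^ n) := by
  have hc : Continuous fun x : Euc n => expPt n κ ρ (hyp n x) :=
    show Continuous fun x : Euc n =>
      ((sn κ ρ • x, sn κ ρ * Real.sqrt (1 + ‖x‖ ^ 2), cs κ ρ / Real.sqrt |κ|) : Amb n) by fun_prop
  refine paramVolume_image_of_conformal a (sn_pos hρ).le hc fun x u v => ?_
  have h1 : ∀ u, fderiv ℝ (fun x : Euc n => expPt n κ ρ (hyp n x)) x u =
      fderiv ℝ (fun z : ℝ × Euc n => expPt n κ z.1 (hyp n z.2)) (ρ, x) (0, u) := by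
    intro u
    have h2 := (hasFDerivAt_expPt κ ρ x).comp x (hasFDerivAt_prodMk_right (𝕜 := ℝ) ρ x)
    rw [← (hasFDerivAt_expPt κ ρ x).fderiv] at h2
    rw [show (fun x : Euc n => expPt n κ ρ (hyp n x)) =
      (fun z : ℝ × Euc n => expPt n κ z.1 (hyp n z.2)) ∘ fun x => (ρ, x) from rfl, h2.fderiv]
    rfl
  rw [h1, h1, ambForm_fderiv_expPt hσ hκ]
  simp

end

section

variable {n : ℕ}

/-! ### Lebesgue measure in hyperbolic polar coordinates -/

/-- The radius function `√(t² - ‖x‖²)` of Minkowski space. -/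
def minkRad (n : ℕ) (q : Mink n) : ℝ := Real.sqrt (q.2 ^ 2 - ‖q.1‖ ^ 2)

theorem mem_minkCone_iff {a : ℝ} (ha : 0 < a) {q : Mink n} :
    q ∈ minkCone n a ↔ ‖q.1‖ * Real.sqrt (1 + a ^ 2) ≤ a * q.2 := by
  unfold minkCone
  rw [mem_ofPred_eq, div_le_iff₀ ha, mul_comm a]

/-- Squaring turns the linear description of the solid cone into `‖x‖ ≤ a r`, with `r` the Minkowski
radius. -/
theorem mul_sqrt_le_iff {a b t : ℝ} (ha : 0 < a) (hb : 0 ≤ b) (ht : 0 ≤ t) :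
    b * Real.sqrt (1 + a ^ 2) ≤ a * t ↔ b ^ 2 ≤ a ^ 2 * (t ^ 2 - b ^ 2) := by
  rw [← pow_le_pow_iff_left₀ (by positivity) (by positivity) two_ne_zero, mul_pow,
    Real.sq_sqrt (by positivity)]
  constructor <;> intro h <;> nlinarith

theorem snd_nonneg_of_mem_minkCone {a : ℝ} (ha : 0 < a) {q : Mink n} (hq : q ∈ minkCone n a) :
    0 ≤ q.2 := by
  rw [mem_minkCone_iff ha] at hq
  have : 0 ≤ a * q.2 := le_trans (by positivity) hq
  exact nonneg_of_mul_nonneg_right this ha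

theorem norm_le_of_mem_minkCone {a : ℝ} (ha : 0 < a) {q : Mink n} (hq : q ∈ minkCone n a) :
    ‖q.1‖ ^ 2 ≤ q.2 ^ 2 ∧ ‖q.1‖ ≤ a * minkRad n q := by
  have h0 := snd_nonneg_of_mem_minkCone ha hq
  rw [mem_minkCone_iff ha, mul_sqrt_le_iff ha (norm_nonneg _) h0] at hq
  have h1 : 0 ≤ q.2 ^ 2 - ‖q.1‖ ^ 2 := by
    have : 0 ≤ a ^ 2 * (q.2 ^ 2 - ‖q.1‖ ^ 2) := le_trans (by positivity) hq
    exact nonneg_of_mul_nonneg_right this (by positivity)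
  refine ⟨by linarith, ?_⟩
  unfold minkRad
  rw [← pow_le_pow_iff_left₀ (norm_nonneg _) (mul_nonneg ha.le (Real.sqrt_nonneg _)) two_ne_zero,
    mul_pow, Real.sq_sqrt h1]
  exact hq

theorem isClosed_minkCone (a : ℝ) : IsClosed (minkCone n a) :=
  isClosed_le (by fun_prop) (by fun_prop)

theorem continuous_minkRad : Continuous (minkRad n) := by
  unfold minkRad
  fun_prop

theorem minkCone_slice {a : ℝ} (ha : 0 < a) {J : Set ℝ} (hJ : J ⊆ Ioi 0) (y : Euc n) :
    Prod.mk y ⁻¹' (minkCone n a ∩ minkRad n ⁻¹' J) =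
      (fun r => Real.sqrt (r ^ 2 + ‖y‖ ^ 2)) '' (J ∩ {r | ‖y‖ ≤ a * r}) := by
  ext t
  constructor
  · rintro ⟨h1, h2⟩
    have h3 := norm_le_of_mem_minkCone ha h1
    refine ⟨_, ⟨h2, h3.2⟩, ?_⟩
    have h4 := h3.1
    simp only at h4
    simp only [minkRad]
    rw [Real.sq_sqrt (by linarith), sub_add_cancel, Real.sqrt_sq]
    exact snd_nonneg_of_mem_minkCone ha h1
  · rintro ⟨r, ⟨hr, h1⟩, rfl⟩
    have hr0 : 0 < r := hJ hr
    have h2 : Real.sqrt (r ^ 2 + ‖y‖ ^ 2) ^ 2 = r ^ 2 + ‖y‖ ^ 2 := Real.sq_sqrt (by positivity)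
    refine ⟨?_, ?_⟩
    · rw [mem_minkCone_iff ha, mul_sqrt_le_iff ha (norm_nonneg _) (Real.sqrt_nonneg _), h2,
        add_sub_cancel_right, ← mul_pow]
      exact pow_le_pow_left₀ (norm_nonneg _) h1 2
    · simp only [mem_preimage, minkRad]
      rwa [h2, add_sub_cancel_right, Real.sqrt_sq hr0.le]

theorem volume_image_sqrt_add {J : Set ℝ} (hJ : J ⊆ Ioi 0) (hJm : MeasurableSet J) (c : ℝ) :
    volume ((fun r => Real.sqrt (r ^ 2 + c ^ 2)) '' J) =
      ∫⁻ r in J, ENNReal.ofReal (r / Real.sqrt (r ^ 2 + c ^ 2)) := by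
  have hd : ∀ r ∈ J, HasDerivWithinAt (fun r => Real.sqrt (r ^ 2 + c ^ 2))
      (r / Real.sqrt (r ^ 2 + c ^ 2)) J r := by
    intro r hr
    have hr0 : 0 < r := hJ hr
    have h1 : HasDerivAt (fun r : ℝ => r ^ 2 + c ^ 2) (2 * r) r := by
      simpa using (hasDerivAt_pow 2 r).add_const (c ^ 2)
    refine ((h1.sqrt (by positivity)).congr_deriv ?_).hasDerivWithinAt
    field_simp
  have hi : InjOn (fun r => Real.sqrt (r ^ 2 + c ^ 2)) J := by
    intro r hr s hs h
    have hr0 : 0 < r := hJ hr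
    have hs0 : 0 < s := hJ hs
    have h1 := (Real.sqrt_inj (by positivity) (by positivity)).1 h
    exact (pow_left_inj₀ hr0.le hs0.le two_ne_zero).1 (by linarith)
  have := lintegral_image_eq_lintegral_abs_deriv_mul hJm hd hi 1
  simp only [Pi.one_apply, mul_one, setLIntegral_one] at this
  rw [this]
  refine setLIntegral_congr_fun hJm fun r hr => ?_
  have hr0 : 0 < r := hJ hr
  rw [abs_of_nonneg (by positivity)]

/-- Substitution `y = r x`: the integrand is homogeneous of degree zero and Lebesgue measure
contributes `rⁿ`. -/
theorem lintegral_scaled_capDensity (a : ℝ) {r : ℝ} (hr : 0 < r) :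
    ∫⁻ y in {y : Euc n | ‖y‖ ≤ a * r}, ENNReal.ofReal (r / Real.sqrt (r ^ 2 + ‖y‖ ^ 2)) =
      capVolume n a * ENNReal.ofReal (r ^ n) := by
  have hm : MeasurableSet {y : Euc n | ‖y‖ ≤ a * r} :=
    (isClosed_le continuous_norm continuous_const).measurableSet
  set H : Euc n → ENNReal := (Metric.closedBall (0 : Euc n) a).indicator
    fun x => ENNReal.ofReal (Real.sqrt (1 + ‖x‖ ^ 2))⁻¹
  have hH : Measurable H :=
    (continuous_capDensity.measurable.ennreal_ofReal).indicator
      Metric.isClosed_closedBall.measurableSet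
  have h1 : ∀ y : Euc n, ({y : Euc n | ‖y‖ ≤ a * r}.indicator
      (fun y => ENNReal.ofReal (r / Real.sqrt (r ^ 2 + ‖y‖ ^ 2))) y) = H (r⁻¹ • y) := by
    intro y
    have hn : ‖r⁻¹ • y‖ = r⁻¹ * ‖y‖ := by
      rw [norm_smul, Real.norm_eq_abs, abs_of_pos (inv_pos.2 hr)]
    have hiff : r⁻¹ • y ∈ Metric.closedBall (0 : Euc n) a ↔ ‖y‖ ≤ a * r := by
      rw [mem_closedBall_zero_iff, hn, inv_mul_le_iff₀ hr, mul_comm]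
    have h2 : r / Real.sqrt (r ^ 2 + ‖y‖ ^ 2) = (Real.sqrt (1 + ‖r⁻¹ • y‖ ^ 2))⁻¹ := by
      have h3 : r ^ 2 + ‖y‖ ^ 2 = r ^ 2 * (1 + ‖r⁻¹ • y‖ ^ 2) := by
        rw [hn]; field_simp
      rw [h3, Real.sqrt_mul (by positivity), Real.sqrt_sq hr.le, div_mul_cancel_left₀ hr.ne']
    by_cases h : ‖y‖ ≤ a * r
    · rw [indicator_of_mem (show y ∈ {y : Euc n | ‖y‖ ≤ a * r} from h), h2]
      simp only [H]
      rw [indicator_of_mem (hiff.2 h)]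
    · rw [indicator_of_notMem (show y ∉ {y : Euc n | ‖y‖ ≤ a * r} from h)]
      simp only [H]
      rw [indicator_of_notMem fun h' => h (hiff.1 h')]
  rw [← lintegral_indicator hm, lintegral_congr h1,
    ← lintegral_map hH (measurable_const_smul r⁻¹),
    Measure.map_addHaar_smul _ (inv_ne_zero hr.ne'), lintegral_smul_measure,
    lintegral_indicator Metric.isClosed_closedBall.measurableSet, finrank_euclideanSpace_fin,
    inv_pow, inv_inv, abs_of_pos (by positivity), smul_eq_mul, mul_comm]
  rfl

/-- Slice over `y ∈ ℝⁿ`, replace `t` by `r = √(t² - ‖y‖²)` on each fibre, exchange the integrals,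
and rescale `y` for fixed `r`. Only a one-dimensional change of variables and a dilation are needed.
-/
theorem volume_minkCone_radii {a : ℝ} (ha : 0 < a) {J : Set ℝ} (hJ : J ⊆ Ioi 0)
    (hJm : MeasurableSet J) :
    volume (minkCone n a ∩ minkRad n ⁻¹' J) =
      capVolume n a * ∫⁻ r in J, ENNReal.ofReal (r ^ n) := by
  have hm : MeasurableSet (minkCone n a ∩ minkRad n ⁻¹' J) :=
    (isClosed_minkCone a).measurableSet.inter (continuous_minkRad.measurable hJm)
  have hm2 : MeasurableSet {z : Euc n × ℝ | ‖z.1‖ ≤ a * z.2} :=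
    (isClosed_le (by fun_prop) (by fun_prop)).measurableSet
  set F : Euc n → ℝ → ENNReal := fun y r => {z : Euc n × ℝ | ‖z.1‖ ≤ a * z.2}.indicator
    (fun z => ENNReal.ofReal (z.2 / Real.sqrt (z.2 ^ 2 + ‖z.1‖ ^ 2))) (y, r)
  have hF : Measurable (Function.uncurry F) := by
    refine Measurable.indicator ?_ hm2
    fun_prop
  have h1 : ∀ y : Euc n, volume (Prod.mk y ⁻¹' (minkCone n a ∩ minkRad n ⁻¹' J)) =
      ∫⁻ r in J, F y r := by
    intro y
    have hm3 : MeasurableSet {r : ℝ | ‖y‖ ≤ a * r} :=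
      (isClosed_le (by fun_prop) (by fun_prop)).measurableSet
    rw [minkCone_slice ha hJ, volume_image_sqrt_add (inter_subset_left.trans hJ) (hJm.inter hm3),
      inter_comm, ← Measure.restrict_restrict hm3, ← lintegral_indicator hm3]
    rfl
  have h2 : ∀ r ∈ J, ∫⁻ y, F y r = capVolume n a * ENNReal.ofReal (r ^ n) := by
    intro r hr
    have hm3 : MeasurableSet {y : Euc n | ‖y‖ ≤ a * r} :=
      (isClosed_le (by fun_prop) (by fun_prop)).measurableSet
    rw [← lintegral_scaled_capDensity a (hJ hr), ← lintegral_indicator hm3]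
    rfl
  rw [Measure.volume_eq_prod, Measure.prod_apply hm, lintegral_congr h1,
    lintegral_lintegral_swap hF.aemeasurable, setLIntegral_congr_fun hJm h2,
    lintegral_const_mul _ (by fun_prop)]

end

section

/-! ### Regions covered by polar coordinates -/

section Lift

variable {W P : Type*}

open Classical in
/-- The map `Φ` as a map into `X`, with the value `p` where it leaves `X`. -/
def liftTo (X : Set W) (p : X) (Φ : ℝ × P → W) (r : ℝ) (x : P) : X :=
  if h : Φ (r, x) ∈ X then ⟨Φ (r, x), h⟩ else p

theorem coe_liftTo {X : Set W} {p : X} {Φ : ℝ × P → W} {r : ℝ} {x : P} (h : Φ (r, x) ∈ X) :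
    (liftTo X p Φ r x : W) = Φ (r, x) := by
  rw [liftTo, dif_pos h]

variable [NormedAddCommGroup W] [NormedSpace ℝ W] [TopologicalSpace P]

/-- Geodesic polar coordinates `Φ` about the tip `p` of the region `X`. -/
structure IsPolarChart (B : W → W → ℝ) (T : W → W) (X : Set W) (p : W) (g : W → ℝ)
    (ψ ψ' : ℝ → ℝ) (κ : ℝ) (D : Set P) (Φ : ℝ × P → W) (V : ℝ × P → W) : Prop where
  radius : IsRadius B T X p g ψ ψ'
  smul_right : ∀ (q v : W) (c : ℝ), B q (c • v) = c * B q v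
  smul_left : ∀ (q v : W) (c : ℝ), B (c • q) v = c * B q v
  compact : IsCompact D
  nonempty : D.Nonempty
  continuous : Continuous Φ
  image_eq : Φ '' (insert 0 (radii κ) ×ˢ D) = X
  rad_eq : ∀ z ∈ insert 0 (radii κ) ×ˢ D, ψ (g (Φ z)) = z.1
  tip_eq : ∀ x, Φ (0, x) = p
  contDiff : ∀ x, ContDiff ℝ 1 fun r => Φ (r, x)
  hasDerivAt : ∀ r x, HasDerivAt (fun r => Φ (r, x)) (V (r, x)) r
  unit : ∀ r x, B (V (r, x)) (V (r, x)) = -1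
  future : ∀ r ∈ insert 0 (radii κ), ∀ x, B (T (Φ (r, x))) (V (r, x)) < 0

namespace IsPolarChart

variable {B : W → W → ℝ} {T : W → W} {X : Set W} {p : W} {g : W → ℝ}
    {ψ ψ' : ℝ → ℝ} {κ : ℝ} {D : Set P} {Φ : ℝ × P → W} {V : ℝ × P → W}
    (H : IsPolarChart B T X p g ψ ψ' κ D Φ V)

include H

theorem mem {r : ℝ} {x : P} (hr : r ∈ insert 0 (radii κ)) (hx : x ∈ D) : Φ (r, x) ∈ X := by
  rw [← H.image_eq]
  exact mem_image_of_mem _ ⟨hr, hx⟩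

/-- The radial field is unit and future directed, so the affinely parametrized radial segment has
constant speed `r' - r`. -/
theorem ofReal_sub_le_properTime {r r' : ℝ} (hr : r ∈ insert 0 (radii κ))
    (hr' : r' ∈ insert 0 (radii κ)) (h : r < r') {x : P} (hx : x ∈ D) :
    IsTimelikeCurve B T X (fun s => Φ (r + s * (r' - r), x)) ∧
      ENNReal.ofReal (r' - r) ≤ properTime B (fun s => Φ (r + s * (r' - r), x)) := by
  have h0 := nonneg_of_mem_insert_radii hr
  have hr'' : r' ∈ radii κ := by
    rcases hr' with rfl | hr'
    · linarith
    · exact hr'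
  have hd : ∀ s : ℝ, HasDerivAt (fun s => Φ (r + s * (r' - r), x))
      ((r' - r) • V (r + s * (r' - r), x)) s := by
    intro s
    have h1 : HasDerivAt (fun s : ℝ => r + s * (r' - r)) (r' - r) s := by
      simpa using ((hasDerivAt_id s).mul_const (r' - r)).const_add r
    exact (H.hasDerivAt (r + s * (r' - r)) x).scomp s h1
  have hI : ∀ s ∈ Icc (0 : ℝ) 1, r + s * (r' - r) ∈ insert 0 (radii κ) := by
    intro s hs
    refine mem_insert_radii_of_le hr'' ?_ ?_
    · have := mul_nonneg hs.1 (sub_nonneg.2 h.le)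
      linarith
    · have := mul_le_of_le_one_left (sub_nonneg.2 h.le) hs.2
      linarith
  have hB : ∀ s : ℝ, B (deriv (fun s => Φ (r + s * (r' - r), x)) s)
      (deriv (fun s => Φ (r + s * (r' - r), x)) s) = -(r' - r) ^ 2 := by
    intro s
    rw [(hd s).deriv, H.smul_right, H.smul_left, H.unit]
    ring
  have hpos : 0 < r' - r := sub_pos.2 h
  refine ⟨⟨?_, fun s hs => H.mem (hI s hs) hx, ?_⟩, ?_⟩
  · have hc : ContDiff ℝ 1 (fun s => Φ (r + s * (r' - r), x)) :=
      (H.contDiff x).comp (by fun_prop : ContDiff ℝ 1 fun s : ℝ => r + s * (r' - r))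
    exact hc.contDiffOn.exists_lipschitzOnWith one_ne_zero (convex_Icc 0 1) isCompact_Icc
  · filter_upwards [ae_restrict_mem measurableSet_Icc] with s hs
    refine ⟨?_, ?_⟩
    · rw [hB]
      nlinarith
    · rw [(hd s).deriv, H.smul_right]
      exact mul_neg_of_pos_of_neg hpos (H.future _ (hI s hs) x)
  · unfold properTime
    simp only [hB, neg_neg, Real.sqrt_sq hpos.le]
    simp

theorem radius_eq_iff {q : W} (hq : q ∈ X) {ρ : ℝ} (hρ : ρ ∈ insert 0 (radii κ)) :
    ψ (g q) = ρ ↔ ∃ x ∈ D, q = Φ (ρ, x) := by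
  constructor
  · intro h
    rw [← H.image_eq] at hq
    obtain ⟨⟨r, x⟩, hz, rfl⟩ := hq
    rw [H.rad_eq _ hz] at h
    exact ⟨x, hz.2, by rw [← h]⟩
  · rintro ⟨x, hx, rfl⟩
    exact H.rad_eq _ ⟨hρ, hx⟩

theorem radius_eq_zero_iff {q : W} (hq : q ∈ X) : ψ (g q) = 0 ↔ q = p := by
  rw [H.radius_eq_iff hq (Or.inl rfl)]
  constructor
  · rintro ⟨x, -, rfl⟩
    exact H.tip_eq x
  · intro h
    obtain ⟨x, hx⟩ := H.nonempty
    exact ⟨x, hx, by rw [h, H.tip_eq]⟩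

theorem coe_image_level {ρ : ℝ} (hρ : ρ ∈ insert 0 (radii κ)) :
    (Subtype.val '' {q : X | ψ (g q) = ρ} : Set W) = (fun x => Φ (ρ, x)) '' D := by
  ext q
  constructor
  · rintro ⟨q, hq, rfl⟩
    obtain ⟨x, hx, h⟩ := (H.radius_eq_iff q.2 hρ).1 hq
    exact ⟨x, hx, h.symm⟩
  · rintro ⟨x, hx, rfl⟩
    exact ⟨⟨_, H.mem hρ hx⟩, H.rad_eq (ρ, x) ⟨hρ, hx⟩, rfl⟩

theorem preimage_radii_inter (J : Set ℝ) (hJ : J ⊆ radii κ) :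
    Φ ⁻¹' (X ∩ {q | ψ (g q) ∈ J}) ∩ (insert 0 (radii κ) ×ˢ D) = J ×ˢ D := by
  ext ⟨r, x⟩
  constructor
  · rintro ⟨⟨-, h⟩, hz⟩
    have h : ψ (g (Φ (r, x))) ∈ J := h
    rw [H.rad_eq _ hz] at h
    exact ⟨h, hz.2⟩
  · rintro ⟨hr, hx⟩
    have hz : (r, x) ∈ insert 0 (radii κ) ×ˢ D := ⟨Or.inr (hJ hr), hx⟩
    refine ⟨⟨H.mem hz.1 hx, ?_⟩, hz⟩
    change ψ (g (Φ (r, x))) ∈ J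
    rwa [H.rad_eq _ hz]

theorem polarModel [MeasurableSpace W] {μ : Measure W} {n : ℕ} {ω : ENNReal}
    (hX : MeasurableSet X)
    (hvol : ∀ J ⊆ radii κ, MeasurableSet J →
      μ (X ∩ {q | ψ (g q) ∈ J}) = ω * ∫⁻ r in J, ENNReal.ofReal (sn κ r ^ n))
    (htip : μ {p} = 0) (h0 : ω ≠ 0) (h1 : ω ≠ ⊤) :
    PolarModel (regionSpace B T μ X) n κ D ω (fun q => ψ (g q))
      (liftTo X ⟨p, H.radius.tip_mem⟩ Φ) := by
  -- `Φ` maps the coordinate domain into `X`, so the default value of `liftTo` never occurs there.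
  have hcoe : ∀ r ∈ insert 0 (radii κ), ∀ x ∈ D,
      (liftTo X ⟨p, H.radius.tip_mem⟩ Φ r x : W) = Φ (r, x) := fun r hr x hx =>
    coe_liftTo (H.mem hr hx)
  have hv : ∀ A : Set W, (regionSpace B T μ X).vol {q : X | (q : W) ∈ A} = μ (X ∩ A) := by
    intro A
    change μ.comap Subtype.val _ = _
    rw [(MeasurableEmbedding.subtype_coe hX).comap_apply]
    congr 1
    exact Subtype.image_preimage_coe X A
  refine ⟨H.compact, H.nonempty, ?_, ?_, ?_, ?_, ?_, ?_, ?_, ?_, ?_, h0, h1⟩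
  · intro q
    obtain ⟨⟨r, x⟩, ⟨hr, hx⟩, h⟩ := H.image_eq.ge q.2
    exact ⟨r, hr, x, hx, Subtype.ext ((hcoe r hr x hx).trans h)⟩
  · intro r hr x hx
    rw [hcoe r hr x hx]
    exact H.rad_eq (r, x) ⟨hr, hx⟩
  · intro x hx y hy
    apply Subtype.ext
    rw [hcoe 0 (Or.inl rfl) x hx, hcoe 0 (Or.inl rfl) y hy, H.tip_eq, H.tip_eq]
  · rw [IsInducing.subtypeVal.continuousOn_iff]
    exact H.continuous.continuousOn.congr fun z hz => hcoe z.1 hz.1 z.2 hz.2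
  · rintro q q' (h | ⟨γ, hγ, hq, hq'⟩) hne
    · exact absurd h hne
    · have := H.radius.lt_of_causal hγ (by rw [hq, hq']; exact fun h => hne (Subtype.ext h))
      rwa [hq, hq'] at this
  · intro q q'
    refine iSup₂_le ?_
    rintro γ ⟨hγ, hq, hq'⟩
    have := H.radius.properTime_le hγ
    rwa [hq, hq'] at this
  · intro r hr r' hr' h x hx
    obtain ⟨hγ, hle⟩ := H.ofReal_sub_le_properTime hr hr' h hx
    refine hle.trans (le_iSup₂_of_le _ ⟨hγ, ?_, ?_⟩ le_rfl)
    · rw [hcoe r hr x hx]; simp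
    · rw [hcoe r' hr' x hx]; simp
  · intro J hJ hJm
    rw [← hvol J hJ hJm]
    exact hv {q | ψ (g q) ∈ J}
  · have : {q : X | ψ (g q) = 0} = {q : X | (q : W) ∈ ({p} : Set W)} := by
      ext q
      exact H.radius_eq_zero_iff q.2
    rw [this, hv]
    exact measure_mono_null inter_subset_right htip

end IsPolarChart
end Lift

/-! ### Lorentzian linear algebra -/

section Algebra

variable {E : Type*} [NormedAddCommGroup E] [InnerProductSpace ℝ E]

/-- Only `(t, x)` has to be causal. After multiplication by `‖x‖²`, the right side minus the left is
`(‖x‖² θ - t⟨x,ξ⟩)² + (t² - ‖x‖²)(‖x‖²‖ξ‖² - ⟨x,ξ⟩²)`. -/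
theorem reverse_cauchy_schwarz {x ξ : E} {t θ : ℝ} (h : ‖x‖ ^ 2 ≤ t ^ 2) :
    (t ^ 2 - ‖x‖ ^ 2) * (θ ^ 2 - ‖ξ‖ ^ 2) ≤ (t * θ - inner ℝ x ξ) ^ 2 := by
  rcases eq_or_ne x 0 with rfl | hx
  · simp only [norm_zero, inner_zero_left, sub_zero]
    nlinarith [sq_nonneg (t * ‖ξ‖)]
  · have hx2 : 0 < ‖x‖ ^ 2 := by positivity
    have hi : (inner ℝ x ξ) ^ 2 ≤ ‖x‖ ^ 2 * ‖ξ‖ ^ 2 := by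
      rw [← mul_pow]
      exact sq_le_sq.2 (by rw [abs_of_nonneg (by positivity : 0 ≤ ‖x‖ * ‖ξ‖)]
                           exact abs_real_inner_le_norm x ξ)
    refine le_of_mul_le_mul_left ?_ hx2
    nlinarith [sq_nonneg (‖x‖ ^ 2 * θ - t * inner ℝ x ξ),
      mul_nonneg (sub_nonneg.2 h) (sub_nonneg.2 hi)]

theorem inner_lt_of_causal {x ξ : E} {t θ : ℝ} (h : ‖x‖ ^ 2 < t ^ 2) (ht : 0 < t) (hθ : 0 < θ)
    (hξ : ‖ξ‖ ^ 2 ≤ θ ^ 2) : 0 < t * θ - inner ℝ x ξ := by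
  have h1 : ‖x‖ < t := lt_of_pow_lt_pow_left₀ 2 ht.le h
  have h2 : ‖ξ‖ ≤ θ := le_of_sq_le_sq hξ hθ.le
  have h3 := real_inner_le_norm x ξ
  have h4 : ‖x‖ * ‖ξ‖ ≤ ‖x‖ * θ := mul_le_mul_of_nonneg_left h2 (norm_nonneg x)
  have h5 : ‖x‖ * θ < t * θ := mul_lt_mul_of_pos_right h1 hθ
  linarith

end Algebra

/-! ### Minkowski space -/

variable {n : ℕ}

theorem minkForm_smul_right (q v : Mink n) (c : ℝ) : minkForm n q (c • v) = c * minkForm n q v := by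
  simp only [minkForm, Prod.smul_fst, Prod.smul_snd, real_inner_smul_right, smul_eq_mul]
  ring

theorem minkForm_smul_left (q v : Mink n) (c : ℝ) : minkForm n (c • q) v = c * minkForm n q v := by
  simp only [minkForm, Prod.smul_fst, Prod.smul_snd, real_inner_smul_left, smul_eq_mul]
  ring

theorem minkForm_self (v : Mink n) : minkForm n v v = ‖v.1‖ ^ 2 - v.2 ^ 2 := by
  simp only [minkForm, real_inner_self_eq_norm_sq, sq]

theorem hasFDerivAt_minkNormSq (q : Mink n) :
    HasFDerivAt (fun q : Mink n => q.2 ^ 2 - ‖q.1‖ ^ 2)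
      ((2 * q.2) • ContinuousLinearMap.snd ℝ (Euc n) ℝ -
        (2 • innerSL ℝ q.1).comp (ContinuousLinearMap.fst ℝ (Euc n) ℝ)) q := by
  have h1 : HasFDerivAt (fun q : Mink n => q.2) (ContinuousLinearMap.snd ℝ (Euc n) ℝ) q :=
    hasFDerivAt_snd
  have h2 : HasFDerivAt (fun q : Mink n => q.1) (ContinuousLinearMap.fst ℝ (Euc n) ℝ) q :=
    hasFDerivAt_fst
  have h3 := HasFDerivAt.comp (g := fun x : Euc n => ‖x‖ ^ 2) q
    (hasStrictFDerivAt_norm_sq q.1).hasFDerivAt h2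
  refine ((h1.pow 2).sub h3).congr_fderiv ?_
  simp

theorem sq_lt_sq_of_mem_minkCone {a : ℝ} (ha : 0 < a) {q : Mink n} (hq : q ∈ minkCone n a)
    (h : q ≠ 0) : ‖q.1‖ ^ 2 < q.2 ^ 2 := by
  obtain ⟨h1, h2⟩ := norm_le_of_mem_minkCone ha hq
  refine lt_of_le_of_ne h1 fun he => h ?_
  rw [minkRad, he, sub_self, Real.sqrt_zero, mul_zero] at h2
  have h3 : q.1 = 0 := norm_le_zero_iff.1 h2
  rw [h3, norm_zero] at he
  exact Prod.ext h3 (by simpa using he.symm)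

theorem isRadius_mink {a : ℝ} (ha : 0 < a) :
    IsRadius (minkForm n) (minkTime n) (minkCone n a) 0 (fun q => q.2 ^ 2 - ‖q.1‖ ^ 2) Real.sqrt
      (fun y => 1 / (2 * Real.sqrt y)) where
  form_zero q := by simp [minkForm]
  contDiff := by
    have : ContDiff ℝ 1 fun q : Mink n => ‖q.1‖ ^ 2 := contDiff_fst.norm_sq ℝ
    fun_prop
  strictMono := by
    refine Real.strictMonoOn_sqrt.mono ?_
    rintro _ ⟨q, hq, rfl⟩
    exact sub_nonneg.2 (norm_le_of_mem_minkCone ha hq).1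
  hasDerivAt q hq h :=
    Real.hasDerivAt_sqrt (sub_pos.2 (sq_lt_sq_of_mem_minkCone ha hq h)).ne'
  lt_of_ne q hq h := by
    have := sq_lt_sq_of_mem_minkCone ha hq h
    simpa using this
  tip_mem := by simp [minkCone]
  grad γ s v hX _ hp hv hT := by
    have hq := hX.self_of_nhds
    have h1 := sq_lt_sq_of_mem_minkCone ha hq hp
    have ht : 0 < (γ s).2 := by
      refine (snd_nonneg_of_mem_minkCone ha hq).lt_of_ne fun h => ?_
      rw [← h] at h1
      nlinarith [sq_nonneg ‖(γ s).1‖]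
    rw [minkForm_self] at hv
    have hθ : 0 < v.2 := by simpa [minkForm, minkTime] using hT
    have h2 := inner_lt_of_causal (ξ := v.1) h1 ht hθ (by linarith)
    have h3 := reverse_cauchy_schwarz (ξ := v.1) (θ := v.2) h1.le
    have h4 : 0 < Real.sqrt ((γ s).2 ^ 2 - ‖(γ s).1‖ ^ 2) := Real.sqrt_pos.2 (by linarith)
    have h5 := Real.sq_sqrt (show 0 ≤ (γ s).2 ^ 2 - ‖(γ s).1‖ ^ 2 by linarith)
    have hd : fderiv ℝ (fun q : Mink n => q.2 ^ 2 - ‖q.1‖ ^ 2) (γ s) v =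
        2 * ((γ s).2 * v.2 - inner ℝ (γ s).1 v.1) := by
      rw [(hasFDerivAt_minkNormSq (γ s)).fderiv]
      simp
      ring
    rw [hd]
    refine ⟨by linarith, ?_⟩
    rw [Real.sqrt_le_left (by positivity), minkForm_self, mul_pow, div_pow, mul_pow, mul_pow,
      h5, div_mul_eq_mul_div, le_div_iff₀ (by linarith)]
    nlinarith

theorem isPolarChart_mink {a : ℝ} (ha : 0 < a) :
    IsPolarChart (minkForm n) (minkTime n) (minkCone n a) 0 (fun q => q.2 ^ 2 - ‖q.1‖ ^ 2) Real.sqrt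
      (fun y => 1 / (2 * Real.sqrt y)) 0 (Metric.closedBall (0 : Euc n) a)
      (fun z => z.1 • hyp n z.2) (fun z => hyp n z.2) where
  radius := isRadius_mink ha
  smul_right := minkForm_smul_right
  smul_left := minkForm_smul_left
  compact := isCompact_closedBall _ _
  nonempty := ⟨0, by simpa using ha.le⟩
  continuous := continuous_fst.smul (continuous_hyp.comp continuous_snd)
  image_eq := by
    ext q
    constructor
    · rintro ⟨⟨r, x⟩, ⟨hr, hx⟩, rfl⟩
      have hr0 := nonneg_of_mem_insert_radii hr
      have hx : ‖x‖ ≤ a := mem_closedBall_zero_iff.1 hx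
      have h1 : ‖x‖ * Real.sqrt (1 + a ^ 2) ≤ a * Real.sqrt (1 + ‖x‖ ^ 2) := by
        rw [mul_sqrt_le_iff ha (norm_nonneg _) (Real.sqrt_nonneg _), Real.sq_sqrt (by positivity),
          add_sub_cancel_right, mul_one]
        exact pow_le_pow_left₀ (norm_nonneg _) hx 2
      rw [mem_minkCone_iff ha]
      simp only [hyp, Prod.smul_fst, Prod.smul_snd, norm_smul, Real.norm_eq_abs, abs_of_nonneg hr0,
        smul_eq_mul]
      nlinarith [mul_le_mul_of_nonneg_left h1 hr0]
    · intro hq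
      by_cases h : q = 0
      · exact ⟨(0, 0), ⟨Or.inl rfl, by simpa using ha.le⟩, by simp [h]⟩
      have h1 := sq_lt_sq_of_mem_minkCone ha hq h
      have h2 : 0 < minkRad n q := Real.sqrt_pos.2 (by linarith)
      have h3 : minkRad n q ^ 2 = q.2 ^ 2 - ‖q.1‖ ^ 2 := Real.sq_sqrt (by linarith)
      have h4 : ‖(minkRad n q)⁻¹ • q.1‖ = (minkRad n q)⁻¹ * ‖q.1‖ := by
        rw [norm_smul, Real.norm_eq_abs, abs_of_pos (inv_pos.2 h2)]
      refine ⟨(minkRad n q, (minkRad n q)⁻¹ • q.1), ⟨Or.inr ⟨h2, fun h => absurd h (lt_irrefl _)⟩,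
        ?_⟩, Prod.ext ?_ ?_⟩
      · rw [mem_closedBall_zero_iff, h4, inv_mul_le_iff₀ h2, mul_comm]
        exact (norm_le_of_mem_minkCone ha hq).2
      · simp [hyp, smul_smul, h2.ne']
      · simp only [hyp, Prod.smul_snd, smul_eq_mul, h4]
        have h5 : 1 + ((minkRad n q)⁻¹ * ‖q.1‖) ^ 2 = ((minkRad n q)⁻¹ * q.2) ^ 2 := by
          field_simp
          linarith
        rw [h5, Real.sqrt_sq (mul_nonneg (inv_nonneg.2 h2.le) (snd_nonneg_of_mem_minkCone ha hq)),
          mul_inv_cancel_left₀ h2.ne']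
  rad_eq := by
    rintro ⟨r, x⟩ ⟨hr, -⟩
    have hr0 := nonneg_of_mem_insert_radii hr
    have h1 := hyp_form_self x
    simp only [Prod.smul_fst, Prod.smul_snd, norm_smul, smul_eq_mul, Real.norm_eq_abs, mul_pow,
      sq_abs]
    rw [← mul_sub, h1, mul_one, Real.sqrt_sq hr0]
  tip_eq x := by simp
  contDiff x := contDiff_id.smul (contDiff_const (c := hyp n x))
  hasDerivAt r x := by simpa using (hasDerivAt_id r).smul_const (hyp n x)
  unit r x := by
    rw [minkForm_self]
    linarith [hyp_form_self x]
  future r _ x := by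
    simpa [minkForm, minkTime] using hyp_snd_pos x

theorem polarModel_mink {a : ℝ} (ha : 0 < a) :
    PolarModel (minkSpace n a) n 0 (Metric.closedBall (0 : Euc n) a) (capVolume n a)
      (fun q : minkCone n a => minkRad n (q : Mink n)) (liftTo (minkCone n a) ⟨0, (isRadius_mink ha).tip_mem⟩
        (fun z => z.1 • hyp n z.2)) := by
  refine (isPolarChart_mink ha).polarModel (isClosed_minkCone a).measurableSet ?_
    (by rw [Measure.volume_eq_prod]; exact measure_singleton 0) (capVolume_ne_zero ha) (capVolume_ne_top a)
  intro J hJ hJm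
  rw [show sn 0 = id from funext sn_zero_left]
  exact volume_minkCone_radii ha (hJ.trans fun r hr => hr.1) hJm

theorem minkTip_eq {a : ℝ} (ha : 0 < a) : minkTip n a = {q : minkCone n a | minkRad n (q : Mink n) = 0} := by
  ext q
  exact ((isPolarChart_mink ha).radius_eq_zero_iff q.2).symm

theorem minkSlice_eq {a ρ : ℝ} (hρ : 0 < ρ) : minkSlice n a ρ = {q : minkCone n a | minkRad n (q : Mink n) = ρ} := by
  ext q
  change _ ↔ Real.sqrt _ = ρ
  rw [Real.sqrt_eq_iff_mul_self_eq_of_pos hρ, ← sq, eq_comm]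
  rfl

theorem minkSliceArea_eq {a ρ : ℝ} (ha : 0 < a) (hρ : 0 < ρ) :
    minkSliceArea n a ρ = capVolume n a * ENNReal.ofReal (sn 0 ρ ^ n) := by
  have hρ' : ρ ∈ radii 0 := ⟨hρ, fun h => absurd h (lt_irrefl _)⟩
  unfold minkSliceArea
  rw [minkSlice_eq hρ]
  have h1 := (isPolarChart_mink (n := n) ha).coe_image_level (Or.inr hρ')
  simp only at h1
  unfold minkRad
  rw [h1, sn_zero_left]
  refine paramVolume_image_of_conformal a hρ.le (continuous_hyp.const_smul ρ) fun x u v => ?_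
  rw [fderiv_fun_const_smul (hasFDerivAt_hyp x).differentiableAt]
  simp only [_root_.smul_apply, minkForm_smul_left, minkForm_smul_right]
  ring

theorem DKN_zero {N : ℕ} (hN : 1 ≤ N) {ρ : ℝ} (hρ : 0 < ρ) : DKN 0 N ρ = ρ / N := by
  obtain ⟨m, rfl⟩ : ∃ m, N = m + 1 := ⟨N - 1, by omega⟩
  unfold DKN
  simp only [zero_div, sn_zero_left, integral_pow, Nat.add_sub_cancel]
  push_cast
  field_simp
  ring

theorem attainsEquality_mink {N : ℕ} {a ρ : ℝ} (ha : 0 < a) (hρ : 0 < ρ) :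
    AttainsEquality (minkSpace (N - 1) a) 0 N (minkTip (N - 1) a) (minkSlice (N - 1) a ρ) ρ
      (minkSliceArea (N - 1) a ρ) := by
  rw [minkTip_eq ha, minkSlice_eq hρ, minkSliceArea_eq ha hρ]
  exact (polarModel_mink ha).attainsEquality (by simp) rfl
    ⟨hρ, fun h => absurd h (lt_irrefl _)⟩ rfl

theorem AttainsEquality.content_mul_dist {X : Type*} [TopologicalSpace X] [MeasurableSpace X]
    {L : Space X} {N : ℕ} {V S : Set X} {ρ : ℝ} {A : ENNReal} (h : AttainsEquality L 0 N V S ρ A)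
    (hN : 1 ≤ N) (hρ : 0 < ρ) :
    L.minkowskiContent S * (L.dist V S).toENNReal = N * L.vol (L.cone V S) := by
  have hN' : (0 : ℝ) < N := by exact_mod_cast hN
  rw [← h.equality, h.dist_eq, EReal.toReal_coe, DKN_zero hN hρ, ENNReal.ofReal_div_of_pos hN',
    ENNReal.ofReal_natCast, EReal.toENNReal_of_ne_top (EReal.coe_ne_top ρ), EReal.toReal_coe,
    mul_left_comm, ENNReal.mul_div_cancel (by exact_mod_cast hN'.ne') (ENNReal.natCast_ne_top N)]

end

section

/-! ### De Sitter and anti-de Sitter spaces -/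

variable {n : ℕ}

theorem ambForm_smul_right (σ : ℝ) (q v : Amb n) (c : ℝ) :
    ambForm n σ q (c • v) = c * ambForm n σ q v := by
  simp only [ambForm, minkForm, Prod.smul_fst, Prod.smul_snd, real_inner_smul_right, smul_eq_mul]
  ring

theorem ambForm_smul_left (σ : ℝ) (q v : Amb n) (c : ℝ) :
    ambForm n σ (c • q) v = c * ambForm n σ q v := by
  simp only [ambForm, minkForm, Prod.smul_fst, Prod.smul_snd, real_inner_smul_left, smul_eq_mul]
  ring

theorem ambForm_self (σ : ℝ) (v : Amb n) :
    ambForm n σ v v = ‖v.1‖ ^ 2 - v.2.1 ^ 2 + σ * v.2.2 ^ 2 := by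
  simp only [ambForm, minkForm_self, sq]

/-- Tangency to the quadric. This is why the gradient condition of `IsRadius` assumes that the curve
stays in the region near `s`. -/
theorem ambForm_eq_zero_of_hasDerivAt {σ c : ℝ} {γ : ℝ → Amb n} {s : ℝ} {v : Amb n}
    (h : ∀ᶠ s' in 𝓝 s, ambForm n σ (γ s') (γ s') = c) (hγ : HasDerivAt γ v s) :
    ambForm n σ (γ s) v = 0 := by
  have h1 : HasDerivAt (fun s => (γ s).1) v.1 s := hγ.fst
  have h2 : HasDerivAt (fun s => (γ s).2.1) v.2.1 s := hγ.snd.fst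
  have h3 : HasDerivAt (fun s => (γ s).2.2) v.2.2 s := hγ.snd.snd
  have h4 := ((h1.norm_sq).sub (h2.pow 2)).add ((h3.pow 2).const_mul σ)
  have h5 : HasDerivAt (fun s => ambForm n σ (γ s) (γ s)) 0 s :=
    (hasDerivAt_const s c).congr_of_eventuallyEq h
  simp only [ambForm_self] at h5
  have h6 := h4.unique h5
  simp only [ambForm, minkForm]
  simp at h6
  linarith

theorem ambForm_expPt {κ σ : ℝ} (hσ : σ * |κ| = -κ) (hκ : κ ≠ 0) (r : ℝ) {u : Mink n}
    (hu : u.2 ^ 2 - ‖u.1‖ ^ 2 = 1) :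
    ambForm n σ (expPt n κ r u) (expPt n κ r u) = 1 / -κ := by
  have h0 : 0 < |κ| := abs_pos.2 hκ
  have h1 : Real.sqrt |κ| ^ 2 = |κ| := Real.sq_sqrt h0.le
  have h2 := cs_sq_add κ r
  have h3 : κ ^ 2 = |κ| ^ 2 := (sq_abs κ).symm
  have h4 : σ * (cs κ r ^ 2 / |κ|) = -(cs κ r ^ 2 / κ) := by
    rw [eq_div_of_mul_eq h0.ne' hσ, div_mul_div_comm, ← sq, ← h3]
    field_simp
  rw [ambForm_self]
  simp only [expPt, norm_smul, Real.norm_eq_abs, mul_pow, sq_abs, div_pow, h1, h4]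
  field_simp
  linear_combination -h2 - κ * sn κ r ^ 2 * hu

theorem image_expPt_eq_quadricCone {κ σ : ℝ} (hσ : σ * |κ| = -κ) (hκ : κ ≠ 0) (a : ℝ)
    {Q : Set (Amb n)} (hQ : Q = {q | ambForm n σ q q = 1 / -κ}) :
    (fun z : ℝ × Euc n => expPt n κ z.1 (hyp n z.2)) ''
      (insert 0 (radii κ) ×ˢ Metric.closedBall 0 a) = quadricCone n Q κ a := by
  ext q
  constructor
  · rintro ⟨⟨r, x⟩, ⟨hr, hx⟩, rfl⟩
    refine ⟨?_, r, hr, hyp n x, ?_, rfl⟩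
    · rw [hQ]
      exact ambForm_expPt hσ hκ r (hyp_form_self x)
    · rw [hypCap_eq_image]
      exact mem_image_of_mem _ hx
  · rintro ⟨-, r, hr, u, hu, rfl⟩
    rw [hypCap_eq_image] at hu
    obtain ⟨x, hx, rfl⟩ := hu
    exact ⟨(r, x), ⟨hr, hx⟩, rfl⟩

theorem expPt_zero (κ : ℝ) (u : Mink n) : expPt n κ 0 u = (0, 0, 1 / Real.sqrt |κ|) := by
  simp [expPt, sn_zero, cs_zero]

theorem exists_polar_of_mem_quadricCone {Q : Set (Amb n)} {κ a : ℝ} {q : Amb n}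
    (hq : q ∈ quadricCone n Q κ a) (hp : q ≠ (0, 0, 1 / Real.sqrt |κ|)) :
    ∃ r ∈ radii κ, 0 < q.2.1 ∧ q.2.1 ^ 2 - ‖q.1‖ ^ 2 = sn κ r ^ 2 ∧
      q.2.2 = cs κ r / Real.sqrt |κ| := by
  obtain ⟨-, r, hr, u, ⟨hu1, hu2, -⟩, rfl⟩ := hq
  rcases hr with rfl | hr
  · exact absurd (expPt_zero κ u) hp
  · refine ⟨r, hr, mul_pos (sn_pos hr) hu2, ?_, rfl⟩
    simp only [expPt, norm_smul, Real.norm_eq_abs, mul_pow, sq_abs]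
    rw [← mul_sub, hu1, mul_one]

theorem exists_cs_of_mem_quadricCone {Q : Set (Amb n)} {κ a : ℝ} {q : Amb n}
    (hq : q ∈ quadricCone n Q κ a) : ∃ r, q.2.2 = cs κ r / Real.sqrt |κ| := by
  obtain ⟨-, r, -, u, -, rfl⟩ := hq
  exact ⟨r, rfl⟩

/-- For `κ > 0` the interval `[0, T_κ)` is not closed, so measurability of the conical region is
obtained by writing it as a continuous image of a σ-compact set. -/
theorem isSigmaCompact_insert_radii (κ : ℝ) : IsSigmaCompact (insert 0 (radii κ)) := by
  have h : IsLocallyClosed (insert 0 (radii κ)) := by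
    refine ⟨{r | 0 < κ → r < Real.pi / Real.sqrt κ}, Ici 0, ?_, isClosed_Ici, ?_⟩
    · by_cases hκ : 0 < κ
      · simp only [hκ, forall_const]
        exact isOpen_Iio
      · simp [hκ]
    · ext r
      constructor
      · rintro (rfl | hr)
        · refine ⟨fun hκ => ?_, self_mem_Ici⟩
          have := Real.sqrt_pos.2 hκ
          have := Real.pi_pos
          positivity
        · exact ⟨hr.2, hr.1.le⟩
      · rintro ⟨h1, h2⟩
        rcases (show (0 : ℝ) ≤ r from h2).eq_or_lt with h0 | h0
        · exact Or.inl h0.symm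
        · exact Or.inr ⟨h0, h1⟩
  have := h.locallyCompactSpace
  exact isSigmaCompact_iff_sigmaCompactSpace.2 inferInstance

theorem IsSigmaCompact.measurableSet {Y : Type*} [TopologicalSpace Y] [T2Space Y]
    [MeasurableSpace Y] [BorelSpace Y] {s : Set Y} (h : IsSigmaCompact s) : MeasurableSet s := by
  obtain ⟨K, hK, rfl⟩ := h
  exact MeasurableSet.iUnion fun m => (hK m).measurableSet

theorem measurableSet_quadricCone {κ σ : ℝ} (hσ : σ * |κ| = -κ) (hκ : κ ≠ 0) (a : ℝ)
    {Q : Set (Amb n)} (hQ : Q = {q | ambForm n σ q q = 1 / -κ}) :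
    MeasurableSet (quadricCone n Q κ a) := by
  rw [← image_expPt_eq_quadricCone hσ hκ a hQ]
  have h1 : IsSigmaCompact (insert 0 (radii κ) ×ˢ Metric.closedBall (0 : Euc n) a) := by
    obtain ⟨K, hK, hU⟩ := isSigmaCompact_insert_radii κ
    refine ⟨fun m => K m ×ˢ Metric.closedBall 0 a,
      fun m => (hK m).prod (isCompact_closedBall _ _), ?_⟩
    rw [← hU, iUnion_prod_const]
  exact IsSigmaCompact.measurableSet (h1.image (continuous_expPt_hyp κ))

theorem contDiff_sn (κ : ℝ) : ContDiff ℝ 1 (sn κ) := by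
  unfold sn
  split_ifs
  · exact (Real.contDiff_sin.comp (by fun_prop)).div_const _
  · exact (Real.contDiff_sinh.comp (by fun_prop)).div_const _
  · fun_prop

theorem contDiff_cs (κ : ℝ) : ContDiff ℝ 1 (cs κ) := by
  unfold cs
  split_ifs
  · exact Real.contDiff_cos.comp (by fun_prop)
  · exact Real.contDiff_cosh.comp (by fun_prop)
  · fun_prop

/-- The unit radial vector field `∂_r` in polar coordinates. -/
def radialField (n : ℕ) (κ : ℝ) (z : ℝ × Euc n) : Amb n :=
  fderiv ℝ (fun z : ℝ × Euc n => expPt n κ z.1 (hyp n z.2)) z (1, 0)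

theorem radialField_eq (κ r : ℝ) (x : Euc n) :
    radialField n κ (r, x) = (cs κ r • (hyp n x).1, cs κ r * (hyp n x).2,
      -κ * sn κ r / Real.sqrt |κ|) := by
  rw [radialField, fderiv_expPt_apply]
  simp

theorem isPolarChart_quadric {κ σ a : ℝ} (hσ : σ * |κ| = -κ) (hκ : κ ≠ 0) (ha : 0 < a)
    {Q : Set (Amb n)} (hQ : Q = {q | ambForm n σ q q = 1 / -κ}) {T : Amb n → Amb n}
    {g : Amb n → ℝ} {ψ ψ' : ℝ → ℝ}
    (hR : IsRadius (ambForm n σ) T (quadricCone n Q κ a) (0, 0, 1 / Real.sqrt |κ|) g ψ ψ')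
    (hrad : ∀ r ∈ insert 0 (radii κ), ∀ x, ψ (g (expPt n κ r (hyp n x))) = r)
    (hT : ∀ r ∈ insert 0 (radii κ), ∀ x,
      ambForm n σ (T (expPt n κ r (hyp n x))) (radialField n κ (r, x)) < 0) :
    IsPolarChart (ambForm n σ) T (quadricCone n Q κ a) (0, 0, 1 / Real.sqrt |κ|) g ψ ψ' κ
      (Metric.closedBall (0 : Euc n) a) (fun z => expPt n κ z.1 (hyp n z.2))
      (radialField n κ) where
  radius := hR
  smul_right := ambForm_smul_right σ
  smul_left := ambForm_smul_left σ
  compact := isCompact_closedBall _ _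
  nonempty := ⟨0, by simpa using ha.le⟩
  continuous := continuous_expPt_hyp κ
  image_eq := image_expPt_eq_quadricCone hσ hκ a hQ
  rad_eq z hz := hrad z.1 hz.1 z.2
  tip_eq x := expPt_zero κ _
  contDiff x := ((contDiff_sn κ).smul (contDiff_const (c := (hyp n x).1))).prodMk
    (((contDiff_sn κ).mul (contDiff_const (c := (hyp n x).2))).prodMk
      ((contDiff_cs κ).div_const (Real.sqrt |κ|)))
  hasDerivAt r x := by
    have h := ((hasDerivAt_sn κ r).smul_const (hyp n x).1).prodMk
      (((hasDerivAt_sn κ r).mul_const (hyp n x).2).prodMk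
        ((hasDerivAt_cs κ r).div_const (Real.sqrt |κ|)))
    rw [radialField_eq]
    exact h
  unit r x := by
    unfold radialField
    rw [ambForm_fderiv_expPt hσ hκ]
    simp [minkForm]
  future := hT

theorem attainsEquality_quadric {κ σ a ρ K : ℝ} {N : ℕ} (hσ : σ * |κ| = -κ) (hκ : κ ≠ 0)
    (ha : 0 < a) {Q : Set (Amb (N - 1))} (hQ : Q = {q | ambForm (N - 1) σ q q = 1 / -κ})
    {T : Amb (N - 1) → Amb (N - 1)} {g : Amb (N - 1) → ℝ} {ψ ψ' : ℝ → ℝ}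
    (hR : IsRadius (ambForm (N - 1) σ) T (quadricCone (N - 1) Q κ a) (0, 0, 1 / Real.sqrt |κ|)
      g ψ ψ')
    (hrad : ∀ r ∈ insert 0 (radii κ), ∀ x, ψ (g (expPt (N - 1) κ r (hyp (N - 1) x))) = r)
    (hT : ∀ r ∈ insert 0 (radii κ), ∀ x,
      ambForm (N - 1) σ (T (expPt (N - 1) κ r (hyp (N - 1) x))) (radialField (N - 1) κ (r, x)) < 0)
    (hm : Measurable fun q => ψ (g q)) (hK : κ = K / ((N : ℝ) - 1)) (hρ : ρ ∈ radii κ) :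
    AttainsEquality (regionSpace (ambForm (N - 1) σ) T (quadricVolume (N - 1) (ambForm (N - 1) σ) κ)
        (quadricCone (N - 1) Q κ a)) K N (quadricTip (N - 1) Q κ a) (quadricSlice (N - 1) Q κ a ρ) ρ
      (quadricSliceArea (N - 1) (ambForm (N - 1) σ) Q κ a ρ) := by
  have H := isPolarChart_quadric hσ hκ ha hQ hR hrad hT
  have hX := measurableSet_quadricCone hσ hκ a hQ
  -- The volume is parametrized by all directions, so points of the region could a priori come from
  -- outside the closed ball. They do not: a common image fixes the radius through `hrad`, and then
  -- the direction since `𝔰_κ(r) ≠ 0`.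
  have hpre : ∀ J ⊆ radii κ,
      (fun z : ℝ × Euc (N - 1) => expPt (N - 1) κ z.1 (hyp (N - 1) z.2)) ⁻¹'
        (quadricCone (N - 1) Q κ a ∩ {q | ψ (g q) ∈ J}) ∩ radii κ ×ˢ univ =
      J ×ˢ Metric.closedBall 0 a := by
    intro J hJ
    rw [← H.preimage_radii_inter J hJ]
    ext ⟨r, x⟩
    constructor
    · rintro ⟨h, hr, -⟩
      refine ⟨h, Or.inr hr, ?_⟩
      obtain ⟨⟨r', x'⟩, ⟨hr', hx'⟩, he⟩ := H.image_eq.ge h.1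
      simp only at he
      have h1 := hrad r (Or.inr hr) x
      rw [← he, hrad r' hr' x'] at h1
      subst h1
      have h2 : sn κ r' • x' = sn κ r' • x := congrArg Prod.fst he
      rw [← smul_right_injective _ (sn_pos hr).ne' h2]
      exact hx'
    · rintro ⟨h, hr, -⟩
      refine ⟨h, ?_, mem_univ _⟩
      have h1 : ψ (g (expPt (N - 1) κ r (hyp (N - 1) x))) ∈ J := h.2
      rw [hrad r hr] at h1
      exact hJ h1
  have hvol : ∀ J ⊆ radii κ, MeasurableSet J →
      quadricVolume (N - 1) (ambForm (N - 1) σ) κ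
        (quadricCone (N - 1) Q κ a ∩ {q | ψ (g q) ∈ J}) =
      capVolume (N - 1) a * ∫⁻ r in J, ENNReal.ofReal (sn κ r ^ (N - 1)) := fun J hJ hJm =>
    quadricVolume_apply hσ hκ (hX.inter (hm hJm)) hJ hJm (hpre J hJ)
  -- The parametrization uses positive radii only, where `t > 0`, so the preimage of the tip is
  -- empty.
  have htip : quadricVolume (N - 1) (ambForm (N - 1) σ) κ {(0, 0, 1 / Real.sqrt |κ|)} = 0 := by
    rw [quadricVolume_apply (a := a) hσ hκ (measurableSet_singleton _) (empty_subset _)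
      MeasurableSet.empty]
    · simp
    · rw [empty_prod, eq_empty_iff_forall_notMem]
      rintro ⟨r, x⟩ ⟨h, hr, -⟩
      have h1 : sn κ r * (hyp (N - 1) x).2 = 0 := congrArg (fun q => q.2.1) h
      exact (mul_pos (sn_pos hr) (hyp_snd_pos x)).ne' h1
  have hmodel := H.polarModel hX hvol htip (capVolume_ne_zero ha) (capVolume_ne_top a)
  have hV : quadricTip (N - 1) Q κ a =
      {q : quadricCone (N - 1) Q κ a | ψ (g (q : Amb (N - 1))) = 0} := by
    ext q
    exact (H.radius_eq_zero_iff q.2).symm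
  have hS : quadricSlice (N - 1) Q κ a ρ =
      {q : quadricCone (N - 1) Q κ a | ψ (g (q : Amb (N - 1))) = ρ} := by
    ext q
    refine Iff.trans ?_ (H.radius_eq_iff q.2 (Or.inr hρ)).symm
    unfold quadricSlice
    rw [hypCap_eq_image, mem_ofPred_eq, exists_mem_image]
  have hA : quadricSliceArea (N - 1) (ambForm (N - 1) σ) Q κ a ρ =
      capVolume (N - 1) a * ENNReal.ofReal (sn κ ρ ^ (N - 1)) := by
    unfold quadricSliceArea
    rw [hS, H.coe_image_level (Or.inr hρ)]
    exact paramVolume_slice hσ hκ hρ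
  rw [hV, hS]
  exact hmodel.attainsEquality hK rfl hρ hA

theorem sqrt_le_inv_sqrt_mul {b c d : ℝ} (hd : 0 < d) (hc : 0 ≤ c) (h : b * d ≤ c ^ 2) :
    Real.sqrt b ≤ (Real.sqrt d)⁻¹ * c := by
  rw [Real.sqrt_le_left (by positivity), mul_pow, inv_pow, Real.sq_sqrt hd.le,
    ← div_eq_inv_mul, le_div_iff₀ hd]
  exact h

theorem fderiv_snd_snd (q v : Amb n) : fderiv ℝ (fun q : Amb n => q.2.2) q v = v.2.2 := by
  have h : HasFDerivAt (fun q : Amb n => q.2.2) ((ContinuousLinearMap.snd ℝ ℝ ℝ).comp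
      (ContinuousLinearMap.snd ℝ (Euc n) (ℝ × ℝ))) q :=
    ((ContinuousLinearMap.snd ℝ ℝ ℝ).comp
      (ContinuousLinearMap.snd ℝ (Euc n) (ℝ × ℝ))).hasFDerivAt
  rw [h.fderiv]
  rfl

/-! #### Anti-de Sitter space -/

theorem antiDeSitter_eq (κ : ℝ) :
    antiDeSitter n (-κ) = {q | ambForm n (-1) q q = 1 / -κ} := by
  rw [antiDeSitter, adSForm_eq]

theorem adS_timeForm (q v : Amb n) :
    ambForm n (-1) (adSTime n q) v = -(q.2.2 * v.2.1 - q.2.1 * v.2.2) := by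
  simp [ambForm, minkForm, adSTime]
  ring

/-- The radius as a function of `-w` in anti-de Sitter space. -/
def adSRadius (κ y : ℝ) : ℝ := Real.arccos (-(Real.sqrt κ * y)) / Real.sqrt κ

theorem hasDerivAt_adSRadius {κ y : ℝ} (hκ : 0 < κ) (h : κ * y ^ 2 < 1) :
    HasDerivAt (adSRadius κ) (Real.sqrt (1 - κ * y ^ 2))⁻¹ y := by
  have hk : 0 < Real.sqrt κ := Real.sqrt_pos.2 hκ
  have h1 : (Real.sqrt κ * y) ^ 2 < 1 := by rwa [mul_pow, Real.sq_sqrt hκ.le]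
  have h2 := abs_lt_of_sq_lt_sq' (h1.trans_eq (one_pow 2).symm) zero_le_one
  have h3 : HasDerivAt (fun y => -(Real.sqrt κ * y)) (-Real.sqrt κ) y := by
    simpa using ((hasDerivAt_id y).const_mul (Real.sqrt κ)).fun_neg
  have h4 := ((Real.hasDerivAt_arccos (x := -(Real.sqrt κ * y)) (by linarith [h2.2])
    (by linarith [h2.1])).comp y h3).div_const (Real.sqrt κ)
  refine h4.congr_deriv ?_
  rw [neg_sq, mul_pow, Real.sq_sqrt hκ.le]
  field_simp

/-- Future causal vectors decrease `w`. The sign cannot be read off from tangency, as `w` itself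
changes sign once `𝔠_κ < 0`. If `ω ≥ 0`, Cauchy–Schwarz gives `(tθ + wω)² ≤ (t² - S)(θ² + ω²)`;
together with `tω(wθ - tω) ≥ 0` this forces `θ = 0`, which contradicts the time orientation. -/
theorem snd_snd_neg_of_future {x ξ : Euc n} {t θ w ω S : ℝ} (ht : 0 < t) (hS : 0 < S)
    (hx : t ^ 2 - ‖x‖ ^ 2 = S) (htan : inner ℝ x ξ - t * θ - w * ω = 0)
    (hv : ‖ξ‖ ^ 2 ≤ θ ^ 2 + ω ^ 2) (hT : 0 < w * θ - t * ω) : ω < 0 := by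
  by_contra! hω
  have h1 : (inner ℝ x ξ) ^ 2 ≤ ‖x‖ ^ 2 * ‖ξ‖ ^ 2 := by
    rw [← mul_pow]
    exact sq_le_sq.2 (by rw [abs_of_nonneg (by positivity : 0 ≤ ‖x‖ * ‖ξ‖)]
                         exact abs_real_inner_le_norm x ξ)
  have h2 : ‖x‖ ^ 2 * ‖ξ‖ ^ 2 ≤ (t ^ 2 - S) * (θ ^ 2 + ω ^ 2) := by
    rw [← hx, sub_sub_cancel]
    exact mul_le_mul_of_nonneg_left hv (sq_nonneg _)
  have h3 : inner ℝ x ξ = t * θ + w * ω := by linarith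
  rw [h3] at h1
  have h4 : 0 ≤ t * ω * (w * θ - t * ω) := by positivity
  have h5 : S * θ ^ 2 ≤ 0 := by
    nlinarith [sq_nonneg (t * ω), sq_nonneg (w * ω), mul_nonneg hS.le (sq_nonneg ω)]
  have h6 : θ = 0 := by
    by_contra hne
    have : 0 < S * θ ^ 2 := by positivity
    linarith
  rw [h6, mul_zero] at hT
  nlinarith [mul_nonneg ht.le hω]

theorem sqrt_mul_cs_div {κ r : ℝ} (hκ : κ ≠ 0) : |κ| * (cs κ r / Real.sqrt |κ|) ^ 2 = cs κ r ^ 2 := by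
  have h0 : 0 < |κ| := abs_pos.2 hκ
  rw [div_pow, Real.sq_sqrt h0.le, mul_div_cancel₀ _ h0.ne']

theorem isRadius_adS {κ a : ℝ} (hκ : 0 < κ) (ha : 0 < a) :
    IsRadius (ambForm n (-1)) (adSTime n) (quadricCone n (antiDeSitter n (-κ)) κ a)
      (0, 0, 1 / Real.sqrt |κ|) (fun q => -q.2.2) (adSRadius κ)
      (fun y => (Real.sqrt (1 - κ * y ^ 2))⁻¹) where
  form_zero q := by simp [ambForm, minkForm]
  contDiff := by fun_prop
  strictMono := by
    have hk : 0 < Real.sqrt κ := Real.sqrt_pos.2 hκ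
    have key : ∀ q ∈ quadricCone n (antiDeSitter n (-κ)) κ a,
        -(Real.sqrt κ * -q.2.2) ∈ Icc (-1 : ℝ) 1 := by
      intro q hq
      obtain ⟨r, hr⟩ := exists_cs_of_mem_quadricCone hq
      rw [hr, abs_of_pos hκ, mul_neg, neg_neg, mul_div_cancel₀ _ hk.ne', cs, if_pos hκ]
      exact Real.cos_mem_Icc _
    rintro _ ⟨q, hq, rfl⟩ _ ⟨q', hq', rfl⟩ h
    refine div_lt_div_of_pos_right (Real.strictAntiOn_arccos (key q' hq') (key q hq) ?_) hk
    exact neg_lt_neg (mul_lt_mul_of_pos_left h hk)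
  hasDerivAt q hq hp := by
    obtain ⟨r, hr, -, -, hw⟩ := exists_polar_of_mem_quadricCone hq hp
    refine hasDerivAt_adSRadius hκ ?_
    have h1 := sqrt_mul_cs_div (r := r) hκ.ne'
    rw [← hw, abs_of_pos hκ] at h1
    have h2 := cs_sq_add κ r
    have h3 := mul_pos hκ (pow_pos (sn_pos hr) 2)
    rw [neg_sq]
    linarith
  lt_of_ne q hq hp := by
    obtain ⟨r, hr, -, -, hw⟩ := exists_polar_of_mem_quadricCone hq hp
    have hk : 0 < Real.sqrt |κ| := Real.sqrt_pos.2 (abs_pos.2 hκ.ne')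
    have h2 := cs_sq_add κ r
    have h3 := mul_pos hκ (pow_pos (sn_pos hr) 2)
    have h4 : cs κ r < 1 := by nlinarith
    simp only [hw]
    exact neg_lt_neg (div_lt_div_of_pos_right h4 hk)
  tip_mem := by
    rw [← image_expPt_eq_quadricCone (by rw [abs_of_pos hκ]; ring) hκ.ne' a (antiDeSitter_eq κ)]
    exact ⟨(0, 0), ⟨Or.inl rfl, by simpa using ha.le⟩, expPt_zero κ _⟩
  grad γ s v hX hγ hp hv hT := by
    have hq := hX.self_of_nhds
    obtain ⟨r, hr, ht, hS, hw⟩ := exists_polar_of_mem_quadricCone hq hp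
    have htan := ambForm_eq_zero_of_hasDerivAt (c := 1 / -κ) (σ := -1)
      (hX.mono fun s' hs' => by
        have := hs'.1
        rwa [antiDeSitter_eq] at this) hγ
    rw [ambForm_self] at hv ⊢
    rw [adS_timeForm] at hT
    simp only [ambForm, minkForm] at htan
    have h1 := sqrt_mul_cs_div (r := r) hκ.ne'
    rw [← hw, abs_of_pos hκ] at h1
    have h2 := cs_sq_add κ r
    have hspos : 0 < sn κ r ^ 2 := pow_pos (sn_pos hr) 2
    have hω : v.2.2 < 0 := snd_snd_neg_of_future (w := (γ s).2.2) (θ := v.2.1) ht hspos hS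
      (by linarith) (by linarith) (by linarith)
    have hd : fderiv ℝ (fun q : Amb n => -q.2.2) (γ s) v = -v.2.2 := by
      rw [fderiv_fun_neg, _root_.neg_apply, fderiv_snd_snd]
    rw [hd]
    refine ⟨by linarith, ?_⟩
    have h3 := mul_pos hκ hspos
    -- Tangency replaces `tθ - ⟨x,ξ⟩` by `-wω`, so `S(θ² - ‖ξ‖²) ≤ w²ω²` with `S = 𝔰_κ²`.
    -- Multiplying by `κ` and adding `κSω²` bounds `κS` times `-B(v,v)` by `(𝔠_κ² + κ𝔰_κ²)ω² = ω²`.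
    have h4 := reverse_cauchy_schwarz (x := (γ s).1) (ξ := v.1) (t := (γ s).2.1) (θ := v.2.1)
      (by linarith)
    rw [hS, show (γ s).2.1 * v.2.1 - inner ℝ (γ s).1 v.1 = -((γ s).2.2 * v.2.2) by linarith] at h4
    refine sqrt_le_inv_sqrt_mul (by rw [neg_sq]; linarith) (by linarith) ?_
    rw [neg_sq, h1, show 1 - cs κ r ^ 2 = κ * sn κ r ^ 2 by linarith]
    nlinarith [mul_le_mul_of_nonneg_left h4 hκ.le]

theorem attainsEquality_adS {κ a ρ K : ℝ} {N : ℕ} (hκ : 0 < κ) (ha : 0 < a)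
    (hK : κ = K / ((N : ℝ) - 1)) (hρ : ρ ∈ radii κ) :
    AttainsEquality (adSSpace (N - 1) κ a) K N
      (quadricTip (N - 1) (antiDeSitter (N - 1) (-κ)) κ a)
      (quadricSlice (N - 1) (antiDeSitter (N - 1) (-κ)) κ a ρ) ρ
      (quadricSliceArea (N - 1) (adSForm (N - 1)) (antiDeSitter (N - 1) (-κ)) κ a ρ) := by
  have hk : 0 < Real.sqrt κ := Real.sqrt_pos.2 hκ
  unfold adSSpace
  rw [adSForm_eq]
  refine attainsEquality_quadric (by rw [abs_of_pos hκ]; ring) hκ.ne' ha (antiDeSitter_eq κ)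
    (isRadius_adS hκ ha) ?_ ?_ ?_ hK hρ
  · intro r hr x
    have h0 := nonneg_of_mem_insert_radii hr
    -- The restriction `r < T_κ` enters here: it keeps `√κ r` on the branch where `arccos` inverts
    -- `cos`.
    have h1 : Real.sqrt κ * r ≤ Real.pi := by
      rcases hr with rfl | hr
      · simpa using Real.pi_pos.le
      · have := (lt_div_iff₀ hk).1 (hr.2 hκ)
        linarith
    simp only [adSRadius, expPt, abs_of_pos hκ]
    rw [mul_neg, neg_neg, mul_div_cancel₀ _ hk.ne', cs, if_pos hκ,
      Real.arccos_cos (by positivity) h1, mul_div_cancel_left₀ _ hk.ne']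
  · intro r _ x
    rw [adS_timeForm, radialField_eq]
    simp only [expPt]
    have h1 := cs_sq_add κ r
    -- The product with the rotation field collapses to `𝔠_κ² + κ𝔰_κ² = 1`, so `∂_r` remains future
    -- directed where `𝔠_κ` is negative.
    have h2 : cs κ r / Real.sqrt |κ| * (cs κ r * (hyp (N - 1) x).2) -
        sn κ r * (hyp (N - 1) x).2 * (-κ * sn κ r / Real.sqrt |κ|) =
        (cs κ r ^ 2 + κ * sn κ r ^ 2) * (hyp (N - 1) x).2 / Real.sqrt |κ| := by ring
    rw [h2, h1, one_mul, abs_of_pos hκ]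
    exact neg_neg_of_pos (div_pos (hyp_snd_pos x) hk)
  · exact (Real.continuous_arccos.comp (by fun_prop)).measurable.div_const _

/-! #### De Sitter space -/

theorem deSitter_eq (κ : ℝ) : deSitter n (-κ) = {q | ambForm n 1 q q = 1 / -κ} := by
  rw [deSitter, dSForm_eq]

/-- The radius as a function of `w` in de Sitter space. -/
def dSRadius (κ y : ℝ) : ℝ := Real.arcosh (Real.sqrt |κ| * y) / Real.sqrt |κ|

theorem hasDerivAt_dSRadius {κ y : ℝ} (hκ : κ ≠ 0) (hy : 0 < y) (h : 1 < |κ| * y ^ 2) :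
    HasDerivAt (dSRadius κ) (Real.sqrt (|κ| * y ^ 2 - 1))⁻¹ y := by
  have h0 : 0 < |κ| := abs_pos.2 hκ
  have hk : 0 < Real.sqrt |κ| := Real.sqrt_pos.2 h0
  have h1 : (Real.sqrt |κ| * y) ^ 2 = |κ| * y ^ 2 := by rw [mul_pow, Real.sq_sqrt h0.le]
  have h2 : 1 < Real.sqrt |κ| * y := by
    refine lt_of_pow_lt_pow_left₀ 2 (by positivity) ?_
    rwa [h1, one_pow]
  have h3 : HasDerivAt (fun y => Real.sqrt |κ| * y) (Real.sqrt |κ|) y := by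
    simpa using (hasDerivAt_id y).const_mul (Real.sqrt |κ|)
  have h4 := ((Real.hasDerivAt_arcosh h2).comp y h3).div_const (Real.sqrt |κ|)
  refine h4.congr_deriv ?_
  rw [h1]
  field_simp

theorem one_le_cs {κ : ℝ} (hκ : κ < 0) (r : ℝ) : 1 ≤ cs κ r := by
  rw [cs, if_neg hκ.not_gt, if_pos hκ]
  exact Real.one_le_cosh _

theorem isRadius_dS {κ a : ℝ} (hκ : κ < 0) (ha : 0 < a) :
    IsRadius (ambForm n 1) (dSTime n) (quadricCone n (deSitter n (-κ)) κ a)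
      (0, 0, 1 / Real.sqrt |κ|) (fun q => q.2.2) (dSRadius κ)
      (fun y => (Real.sqrt (|κ| * y ^ 2 - 1))⁻¹) where
  form_zero q := by simp [ambForm, minkForm]
  contDiff := by fun_prop
  strictMono := by
    have hk : 0 < Real.sqrt |κ| := Real.sqrt_pos.2 (abs_pos.2 hκ.ne)
    have key : ∀ q ∈ quadricCone n (deSitter n (-κ)) κ a,
        Real.sqrt |κ| * q.2.2 ∈ Ioi (0 : ℝ) := by
      intro q hq
      obtain ⟨r, hr⟩ := exists_cs_of_mem_quadricCone hq
      rw [hr, mul_div_cancel₀ _ hk.ne']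
      exact zero_lt_one.trans_le (one_le_cs hκ r)
    rintro _ ⟨q, hq, rfl⟩ _ ⟨q', hq', rfl⟩ h
    exact div_lt_div_of_pos_right (Real.strictMonoOn_arcosh (key q hq) (key q' hq')
      (mul_lt_mul_of_pos_left h hk)) hk
  hasDerivAt q hq hp := by
    obtain ⟨r, hr, -, -, hw⟩ := exists_polar_of_mem_quadricCone hq hp
    have hk : 0 < Real.sqrt |κ| := Real.sqrt_pos.2 (abs_pos.2 hκ.ne)
    have h1 := sqrt_mul_cs_div (r := r) hκ.ne
    rw [← hw] at h1
    refine hasDerivAt_dSRadius hκ.ne ?_ ?_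
    · rw [hw]
      exact div_pos (zero_lt_one.trans_le (one_le_cs hκ r)) hk
    · have h2 := cs_sq_add κ r
      have h3 := mul_pos (neg_pos.2 hκ) (pow_pos (sn_pos hr) 2)
      rw [h1]
      linarith
  lt_of_ne q hq hp := by
    obtain ⟨r, hr, -, -, hw⟩ := exists_polar_of_mem_quadricCone hq hp
    have hk : 0 < Real.sqrt |κ| := Real.sqrt_pos.2 (abs_pos.2 hκ.ne)
    have h2 := cs_sq_add κ r
    have h3 := mul_pos (neg_pos.2 hκ) (pow_pos (sn_pos hr) 2)
    have h4 : 1 < cs κ r := by nlinarith [one_le_cs hκ r]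
    simp only [hw]
    exact div_lt_div_of_pos_right h4 hk
  tip_mem := by
    rw [← image_expPt_eq_quadricCone (by rw [abs_of_neg hκ]; ring) hκ.ne a (deSitter_eq κ)]
    exact ⟨(0, 0), ⟨Or.inl rfl, by simpa using ha.le⟩, expPt_zero κ _⟩
  grad γ s v hX hγ hp hv hT := by
    have hq := hX.self_of_nhds
    obtain ⟨r, hr, ht, hS, hw⟩ := exists_polar_of_mem_quadricCone hq hp
    have hk : 0 < Real.sqrt |κ| := Real.sqrt_pos.2 (abs_pos.2 hκ.ne)
    have htan := ambForm_eq_zero_of_hasDerivAt (c := 1 / -κ) (σ := 1)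
      (hX.mono fun s' hs' => by
        have := hs'.1
        rwa [deSitter_eq] at this) hγ
    rw [ambForm_self] at hv ⊢
    have hθ : 0 < v.2.1 := by simpa [ambForm, minkForm, dSTime] using hT
    simp only [ambForm, minkForm] at htan
    have hw0 : 0 < (γ s).2.2 := by
      rw [hw]
      exact div_pos (zero_lt_one.trans_le (one_le_cs hκ r)) hk
    have h1 := sqrt_mul_cs_div (r := r) hκ.ne
    rw [← hw] at h1
    have h2 := cs_sq_add κ r
    have hspos : 0 < sn κ r ^ 2 := pow_pos (sn_pos hr) 2
    have h5 := inner_lt_of_causal (x := (γ s).1) (ξ := v.1) (by linarith) ht hθ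
      (by nlinarith [sq_nonneg v.2.2])
    have h6 : (γ s).2.1 * v.2.1 - inner ℝ (γ s).1 v.1 = (γ s).2.2 * v.2.2 := by linarith
    have hω : 0 < v.2.2 := by
      rw [h6] at h5
      exact pos_of_mul_pos_right h5 hw0.le
    rw [fderiv_snd_snd]
    refine ⟨hω, ?_⟩
    have h3 := mul_pos (neg_pos.2 hκ) hspos
    -- As in the anti-de Sitter case, now with `-B(v,v) = θ² - ‖ξ‖² - ω²`: the bound is `(|κ|w² -
    -- |κ|S)ω² = ω²`.
    have h4 := reverse_cauchy_schwarz (x := (γ s).1) (ξ := v.1) (t := (γ s).2.1) (θ := v.2.1)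
      (by linarith)
    rw [hS, h6] at h4
    refine sqrt_le_inv_sqrt_mul (by rw [h1]; linarith) hω.le ?_
    rw [h1, show cs κ r ^ 2 - 1 = -κ * sn κ r ^ 2 by linarith]
    rw [abs_of_neg hκ] at h1
    nlinarith [mul_le_mul_of_nonneg_left h4 (neg_nonneg.2 hκ.le)]

theorem attainsEquality_dS {κ a ρ K : ℝ} {N : ℕ} (hκ : κ < 0) (ha : 0 < a)
    (hK : κ = K / ((N : ℝ) - 1)) (hρ : ρ ∈ radii κ) :
    AttainsEquality (dSSpace (N - 1) κ a) K N
      (quadricTip (N - 1) (deSitter (N - 1) (-κ)) κ a)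
      (quadricSlice (N - 1) (deSitter (N - 1) (-κ)) κ a ρ) ρ
      (quadricSliceArea (N - 1) (dSForm (N - 1)) (deSitter (N - 1) (-κ)) κ a ρ) := by
  have hk : 0 < Real.sqrt |κ| := Real.sqrt_pos.2 (abs_pos.2 hκ.ne)
  unfold dSSpace
  rw [dSForm_eq]
  refine attainsEquality_quadric (by rw [abs_of_neg hκ]; ring) hκ.ne ha (deSitter_eq κ)
    (isRadius_dS hκ ha) ?_ ?_ ?_ hK hρ
  · intro r hr x
    have h0 := nonneg_of_mem_insert_radii hr
    simp only [dSRadius, expPt]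
    rw [mul_div_cancel₀ _ hk.ne', cs, if_neg hκ.not_gt, if_pos hκ, abs_of_neg hκ] at *
    rw [Real.arcosh_cosh (by positivity), mul_div_cancel_left₀ _ hk.ne']
  · intro r _ x
    rw [radialField_eq]
    have := mul_pos (zero_lt_one.trans_le (one_le_cs hκ r)) (hyp_snd_pos x)
    simpa [ambForm, minkForm, dSTime] using this
  · unfold dSRadius Real.arcosh
    fun_prop

end

end LorentzIsop

end

/-! ### The three model cases -/

open LorentzIsop in
theorem proposition5p6 (N : ℕ) (hN : 2 ≤ N) :
    -- K = 0: Minkowski space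
    (∀ a ρ : ℝ, 0 < a → 0 < ρ →
      AttainsEquality (minkSpace (N - 1) a) 0 N
        (minkTip (N - 1) a) (minkSlice (N - 1) a ρ) ρ (minkSliceArea (N - 1) a ρ) ∧
      (minkSpace (N - 1) a).minkowskiContent (minkSlice (N - 1) a ρ) *
          ((minkSpace (N - 1) a).dist (minkTip (N - 1) a) (minkSlice (N - 1) a ρ)).toENNReal =
        N * (minkSpace (N - 1) a).vol
          ((minkSpace (N - 1) a).cone (minkTip (N - 1) a) (minkSlice (N - 1) a ρ))) ∧
    -- K > 0: the model space with Ric = K on unit timelike vectors (sectional curvature -κ < 0)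
    (∀ K κ a ρ : ℝ, 0 < K → κ = K / ((N : ℝ) - 1) → 0 < a → ρ ∈ radii κ →
      AttainsEquality (adSSpace (N - 1) κ a) K N
        (quadricTip (N - 1) (antiDeSitter (N - 1) (-κ)) κ a)
        (quadricSlice (N - 1) (antiDeSitter (N - 1) (-κ)) κ a ρ) ρ
        (quadricSliceArea (N - 1) (adSForm (N - 1)) (antiDeSitter (N - 1) (-κ)) κ a ρ)) ∧
    -- K < 0: the model space with Ric = K on unit timelike vectors (sectional curvature -κ > 0)
    (∀ K κ a ρ : ℝ, K < 0 → κ = K / ((N : ℝ) - 1) → 0 < a → ρ ∈ radii κ →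
      AttainsEquality (dSSpace (N - 1) κ a) K N
        (quadricTip (N - 1) (deSitter (N - 1) (-κ)) κ a)
        (quadricSlice (N - 1) (deSitter (N - 1) (-κ)) κ a ρ) ρ
        (quadricSliceArea (N - 1) (dSForm (N - 1)) (deSitter (N - 1) (-κ)) κ a ρ)) := by
  have hN' : 0 < (N : ℝ) - 1 := by
    have : (2 : ℝ) ≤ N := by exact_mod_cast hN
    linarith
  refine ⟨fun a ρ ha hρ => ?_, fun K κ a ρ hK hκ ha hρ => ?_, fun K κ a ρ hK hκ ha hρ => ?_⟩
  · have h := attainsEquality_mink (N := N) ha hρ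
    exact ⟨h, h.content_mul_dist (by omega) hρ⟩
  · exact attainsEquality_adS (hκ ▸ div_pos hK hN') ha hκ hρ
  · exact attainsEquality_dS (hκ ▸ div_neg_of_neg_of_pos hK hN') ha hκ hρ
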